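/- Let $d \in \mathbb{N}$, $\epsilon_1,\epsilon_2,\epsilon_3 > 0$ and $s,t \in (0,d]$ be such that $$s + t > d + 2(\epsilon_1+\epsilon_2+\epsilon_3),$$ and let $\varphi \in C^\infty_c(\mathbb{R}^d)$ be non-negative with $\int \varphi = 1$. Then there exists $\Delta_0 > 0$, depending only on $d,\epsilon_1,\epsilon_2,\epsilon_3,\varphi,s,t$, such that for every $\Delta \in (0,\Delta_0]$ and every Radon measure $X$ on $\mathbb{R}^d$ with $\|X\|_{\dot H^{s/2}} \le \Delta^{-\epsilon_3}$, $$\mathcal{H}^t_\infty\big(X(\Delta,\epsilon_1) \setminus \operatorname{spt} X\big) \le \Delta^{\epsilon_2}.$$ Here $X(\Delta,\epsilon) := \{x \in B(1) : (X * \varphi_\Delta)(x) \ge \Delta^{\epsilon}\}$, where $B(1)$ is the closed unit ball centred at the origin, $\varphi_\Delta(x) = \Delta^{-d}\varphi(x/\Delta)$, and $(X * \varphi_\Delta)(x) = \int \varphi_\Delta(x-y)\,dX(y)$; $\mathcal{H}^t_\infty(A) = \inf\{\sum_i \operatorname{diam}(U_i)^t : A \subset \bigcup_{i} U_i\}$ is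 the $t$-dimensional Hausdorff content (infimum over countable covers); and $\|X\|_{\dot H^{\sigma}}^2 = \int_{\mathbb{R}^d} |\widehat{X}(\xi)|^2 |\xi|^{2\sigma}\,d\xi$, where $\widehat X(\xi) = \int e^{-2\pi i \langle x,\xi\rangle}\,dX(x)$ if $X$ is finite. If $X$ is infinite, $\widehat X$ is the Fourier transform of $X$ as a tempered distribution, and the norm is $\infty$ unless $X$ is tempered and $\widehat X$ is a locally integrable function. -/

import Mathlib

open MeasureTheory
open scoped ENNReal ContDiff FourierTransform SchwartzMap

noncomputable section

/-- The `t`-dimensional Hausdorff content `ℋ^t_∞(A)`: the infimum of `∑ diam(Uᵢ)^t` over all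
countable covers of `A` by arbitrary sets. -/
def hausdorffContent {d : ℕ} (t : ℝ) (A : Set (EuclideanSpace ℝ (Fin d))) : ℝ≥0∞ :=
  ⨅ (U : ℕ → Set (EuclideanSpace ℝ (Fin d))) (_ : A ⊆ ⋃ i, U i), ∑' i, Metric.ediam (U i) ^ t

/-- `g` is the Fourier transform of the measure `X`: `X` is a tempered distribution, and its
distributional Fourier transform is (integration against) the locally integrable function `g`.
If `X` is finite, this holds for `g ξ = ∫ exp (-2πi ⟨x, ξ⟩) dX(x)`, and `g` is always unique up to
null sets. The condition `integrable_mul` says that `g` itself acts on Schwartz functions; it is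
automatic for locally integrable `g` with `∫ |g ξ|² |ξ|^(2σ) dξ < ∞`. -/
structure IsFourierTransformOf {d : ℕ} (X : Measure (EuclideanSpace ℝ (Fin d)))
    (g : EuclideanSpace ℝ (Fin d) → ℂ) : Prop where
  temperate : X.HasTemperateGrowth
  locallyIntegrable : LocallyIntegrable g volume
  integrable_mul : ∀ f : 𝓢(EuclideanSpace ℝ (Fin d), ℂ),
    Integrable (fun ξ => f ξ * g ξ) volume
  integral_fourier : ∀ f : 𝓢(EuclideanSpace ℝ (Fin d), ℂ),
    ∫ x, 𝓕 (f : EuclideanSpace ℝ (Fin d) → ℂ) x ∂X = ∫ ξ, f ξ * g ξ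

/-- The homogeneous Sobolev norm `‖X‖_{Ḣ^σ} = (∫ |X̂(ξ)|² |ξ|^(2σ) dξ)^(1/2) ∈ [0, ∞]`. The Fourier
transform `X̂` is unique up to null sets, so the infimum is over at most one value; it is `∞` when
`X̂` is not a locally integrable function. -/
def homSobolevNorm {d : ℕ} (σ : ℝ) (X : Measure (EuclideanSpace ℝ (Fin d))) : ℝ≥0∞ :=
  (⨅ (g : EuclideanSpace ℝ (Fin d) → ℂ) (_ : IsFourierTransformOf X g),
    ∫⁻ ξ, ‖g ξ‖ₑ ^ (2 : ℝ) * ‖ξ‖ₑ ^ (2 * σ)) ^ (1 / 2 : ℝ)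

/-- The rescaling `φ_Δ(x) = Δ^(-d) φ(x / Δ)`. -/
def rescale {d : ℕ} (φ : EuclideanSpace ℝ (Fin d) → ℝ) (Δ : ℝ) :
    EuclideanSpace ℝ (Fin d) → ℝ :=
  fun x => (Δ ^ d)⁻¹ * φ (Δ⁻¹ • x)

/-- The mollification `X_Δ(x) = (X ∗ φ_Δ)(x) = ∫ φ_Δ(x - y) dX(y)`. -/
def mollify {d : ℕ} (φ : EuclideanSpace ℝ (Fin d) → ℝ) (X : Measure (EuclideanSpace ℝ (Fin d)))
    (Δ : ℝ) (x : EuclideanSpace ℝ (Fin d)) : ℝ :=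
  ∫ y, rescale φ Δ (x - y) ∂X

/-- The set `X(Δ, ε) = {x ∈ B(1) : X_Δ(x) ≥ Δ^ε}`, where `B(1)` is the closed unit ball. -/
def richSet {d : ℕ} (φ : EuclideanSpace ℝ (Fin d) → ℝ) (X : Measure (EuclideanSpace ℝ (Fin d)))
    (Δ ε : ℝ) : Set (EuclideanSpace ℝ (Fin d)) :=
  {x | x ∈ Metric.closedBall 0 1 ∧ Δ ^ ε ≤ mollify φ X Δ x}

end

/-! ### Weighted sums along dyadic recursions -/

section DyadicRecursion

variable {F : Type*} [NormedAddCommGroup F]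

/-! Let u(τ, x) be the average of X against the heat kernel of width √τ; on the Fourier side it is
exp(-πτ|ξ|²) X̂(ξ). Since X is positive, u(τ, ·) dominates X ∗ φ_Δ up to a constant when τ ≈ Δ². The
energy ∫ |X̂|² |ξ|^s gives a gain in τ only for multipliers that vanish at ξ = 0. The operations
f(τ) ↦ f(2τ) - 2^j f(τ), for j = 0, …, J, turn exp(-y) into a multiplier that is O(y^(J+1)) at 0,
and this suffices once J + 1 ≥ s/4.

The price is that u must be recovered from its differences, and this is where x ∉ spt X enters: u(τ,
x) then decays faster than any power as τ → 0, so the sum of 2^(ak) |u(2^(1-k), x)| over k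
converges. Convergence lets the recursion be inverted inside weighted sums: `exists_weighted_sum_le`
bounds this sum by the same sum for the last difference plus the values at τ = 2 of the differences
of orders 1, …, J. The energy bounds those values. The value of u itself at τ = 2, which it need not
control, does not occur because 2^a > 1. An irrational a avoids the resonances 2^a = 2^j.

If (X ∗ φ_Δ)(x) ≥ Δ^ε₁, the sum is at least of order Δ^(ε₁-2a), which beats the low-frequency
contribution Δ^(-ε₃). Hence the last difference is large at some scale τ = 2^(1-k)
(`exists_heatPairing_ge`). The set where it exceeds λ has content at most a constant times
τ^((s+t-d)/2) λ⁻² times the energy (`exists_hausdorffContent_heatPairing_le`). Summing over k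
requires 4a < s + t - d and gives a constant times Δ^(4a-2ε₁-2ε₃); the hypothesis leaves room for 4a
> 2(ε₁+ε₂+ε₃). -/

lemma weighted_recursion_bounds [NormedSpace ℝ F] {b c : ℝ} (hb : 0 < b) (hc : 0 ≤ c) {x y : ℕ → F}
    (hxy : ∀ k, y (k + 1) = x k - c • x (k + 1)) (hx : Summable fun k => b ^ k * ‖x k‖) :
    (Summable fun k => b ^ k * ‖y k‖) ∧
    (b - c) * (∑' k, b ^ k * ‖x k‖) ≤ ∑' k, b ^ k * ‖y k‖ ∧
    |b - c| * (∑' k, b ^ k * ‖x k‖) ≤ (∑' k, b ^ k * ‖y k‖) + c * ‖x 0‖ := by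
  have hx1 : Summable fun k => b ^ (k + 1) * ‖x (k + 1)‖ :=
    (summable_nat_add_iff (f := fun k => b ^ k * ‖x k‖) 1).2 hx
  have hup : ∀ k, b ^ (k + 1) * ‖y (k + 1)‖
      ≤ b * (b ^ k * ‖x k‖) + c * (b ^ (k + 1) * ‖x (k + 1)‖) := by
    intro k
    have h1 : ‖y (k + 1)‖ ≤ ‖x k‖ + c * ‖x (k + 1)‖ := by
      rw [hxy]
      refine (norm_sub_le _ _).trans ?_
      rw [norm_smul, Real.norm_of_nonneg hc]
    calc _ ≤ b ^ (k + 1) * (‖x k‖ + c * ‖x (k + 1)‖) := by gcongr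
      _ = _ := by ring
  have hy1 : Summable fun k => b ^ (k + 1) * ‖y (k + 1)‖ :=
    Summable.of_nonneg_of_le (fun k => by positivity) hup ((hx.mul_left b).add (hx1.mul_left c))
  have hy : Summable fun k => b ^ k * ‖y k‖ :=
    (summable_nat_add_iff (f := fun k => b ^ k * ‖y k‖) 1).1 hy1
  have ex : ∑' k, b ^ k * ‖x k‖ = ‖x 0‖ + ∑' k, b ^ (k + 1) * ‖x (k + 1)‖ := by
    rw [hx.tsum_eq_zero_add]; simp
  have ey : ∑' k, b ^ k * ‖y k‖ = ‖y 0‖ + ∑' k, b ^ (k + 1) * ‖y (k + 1)‖ := by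
    rw [hy.tsum_eq_zero_add]; simp
  -- The useful direction when b > c: the sum on the right lacks the term k = 0, so no boundary
  -- value is lost.
  have k1 : b * (∑' k, b ^ k * ‖x k‖)
      ≤ (∑' k, b ^ (k + 1) * ‖y (k + 1)‖) + c * ∑' k, b ^ (k + 1) * ‖x (k + 1)‖ := by
    rw [← tsum_mul_left, ← tsum_mul_left, ← hy1.tsum_add (hx1.mul_left c)]
    refine (hx.mul_left b).tsum_le_tsum (fun k => ?_) (hy1.add (hx1.mul_left c))
    have h1 : ‖x k‖ ≤ ‖y (k + 1)‖ + c * ‖x (k + 1)‖ := by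
      have : x k = y (k + 1) + c • x (k + 1) := by rw [hxy]; abel
      rw [this]
      refine (norm_add_le _ _).trans ?_
      rw [norm_smul, Real.norm_of_nonneg hc]
    calc _ = b ^ (k + 1) * ‖x k‖ := by ring
      _ ≤ b ^ (k + 1) * (‖y (k + 1)‖ + c * ‖x (k + 1)‖) := by gcongr
      _ = _ := by ring
  -- The useful direction when b < c. The boundary value is then unavoidable: x k = c^(-k) x 0 makes
  -- every y (k + 1) vanish.
  have k2 : c * (∑' k, b ^ (k + 1) * ‖x (k + 1)‖)
      ≤ (∑' k, b ^ (k + 1) * ‖y (k + 1)‖) + b * ∑' k, b ^ k * ‖x k‖ := by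
    rw [← tsum_mul_left, ← tsum_mul_left, ← hy1.tsum_add (hx.mul_left b)]
    refine (hx1.mul_left c).tsum_le_tsum (fun k => ?_) (hy1.add (hx.mul_left b))
    have h1 : c * ‖x (k + 1)‖ ≤ ‖y (k + 1)‖ + ‖x k‖ := by
      have : c • x (k + 1) = x k - y (k + 1) := by rw [hxy]; abel
      calc _ = ‖c • x (k + 1)‖ := by rw [norm_smul, Real.norm_of_nonneg hc]
        _ ≤ _ := by rw [this, add_comm ‖y (k + 1)‖]; exact norm_sub_le (x k) (y (k + 1))
    calc _ = b ^ (k + 1) * (c * ‖x (k + 1)‖) := by ring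
      _ ≤ b ^ (k + 1) * (‖y (k + 1)‖ + ‖x k‖) := by gcongr
      _ = _ := by ring
  have n1 := norm_nonneg (y 0)
  have n2 : 0 ≤ c * ‖x 0‖ := by positivity
  refine ⟨hy, ?_, ?_⟩
  · rw [ey]; rw [ex] at k1 ⊢; nlinarith
  · rcases abs_cases (b - c) with ⟨h, -⟩ | ⟨h, -⟩ <;> rw [h, ey] <;> rw [ex] at k1 k2 ⊢ <;>
      nlinarith

/-- Each order is inverted at the cost of a factor 1/|b - 2^j|. At order 0 the inequality b > 1
removes the boundary term, so `w 0 0` is absent on the right. -/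
lemma exists_weighted_sum_le [NormedSpace ℝ F] (b : ℝ) (hb : 1 < b) (hb2 : ∀ j : ℕ, b ≠ 2 ^ j) (J : ℕ) :
    ∃ C : ℝ, 0 < C ∧ ∀ w : ℕ → ℕ → F,
      (∀ j k, w (j + 1) (k + 1) = w j k - (2 ^ j : ℝ) • w j (k + 1)) →
      (Summable fun k => b ^ k * ‖w 0 k‖) →
      (Summable fun k => b ^ k * ‖w (J + 1) k‖) ∧
      ∑' k, b ^ k * ‖w 0 k‖ ≤
        C * ((∑' k, b ^ k * ‖w (J + 1) k‖) + ∑ j ∈ Finset.range J, ‖w (j + 1) 0‖) := by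
  have hb0 : 0 < b := by linarith
  induction J with
  | zero =>
    refine ⟨(b - 1)⁻¹, by rw [inv_pos]; linarith, fun w hw h0 => ?_⟩
    obtain ⟨h1, h2, -⟩ := weighted_recursion_bounds hb0 (c := 2 ^ 0) (by positivity) (hw 0) h0
    refine ⟨h1, ?_⟩
    rw [pow_zero] at h2
    rw [Finset.sum_range_zero, add_zero, inv_mul_eq_div, le_div_iff₀ (by linarith)]
    linarith
  | succ J ih =>
    obtain ⟨C, hC, h⟩ := ih
    have hd : 0 < |b - 2 ^ (J + 1)| := abs_pos.2 (sub_ne_zero.2 (hb2 _))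
    set D := |b - 2 ^ (J + 1)| with hD
    refine ⟨C * (D⁻¹ * 2 ^ (J + 1) + D⁻¹ + 1), by positivity, fun w hw h0 => ?_⟩
    obtain ⟨s1, h1⟩ := h w hw h0
    obtain ⟨s2, -, h2⟩ := weighted_recursion_bounds hb0 (c := 2 ^ (J + 1)) (by positivity)
      (hw (J + 1)) s1
    refine ⟨s2, h1.trans ?_⟩
    rw [mul_assoc]
    refine mul_le_mul_of_nonneg_left ?_ hC.le
    rw [← hD] at h2
    set A := ∑' k, b ^ k * ‖w (J + 1) k‖
    set B := ∑' k, b ^ k * ‖w (J + 1 + 1) k‖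
    have hB : 0 ≤ B := tsum_nonneg fun k => by positivity
    rw [Finset.sum_range_succ]
    have hS : 0 ≤ ∑ j ∈ Finset.range J, ‖w (j + 1) 0‖ := Finset.sum_nonneg fun _ _ => norm_nonneg _
    set S := ∑ j ∈ Finset.range J, ‖w (j + 1) 0‖
    have hx := norm_nonneg (w (J + 1) 0)
    set x := ‖w (J + 1) 0‖
    have h3 : A ≤ D⁻¹ * (B + 2 ^ (J + 1) * x) := by
      rw [inv_mul_eq_div, le_div_iff₀ hd]; linarith
    have e1 : 0 ≤ D⁻¹ * 2 ^ (J + 1) * (B + S) := by positivity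
    have e2 : 0 ≤ D⁻¹ * (S + x) := by positivity
    nlinarith

/-- Pigeonhole: the weights (1 - ρ) ρ^k sum to 1, so some term reaches its share of M. -/
lemma exists_term_ge_of_le_weighted_sum {b ρ M : ℝ} (hρ : 0 < ρ) (hρ1 : ρ < 1) {x : ℕ → F}
    (hx : Summable fun k => b ^ k * ‖x k‖) (hM : M ≤ ∑' k, b ^ k * ‖x k‖) :
    ∃ k, M * (1 - ρ) * ρ ^ k ≤ b ^ k * ‖x k‖ := by
  by_contra! h
  have hs : Summable fun k : ℕ => M * (1 - ρ) * ρ ^ k :=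
    (summable_geometric_of_lt_one hρ.le hρ1).mul_left _
  have := hx.tsum_lt_tsum (fun k => (h k).le) (h 0) hs
  rw [tsum_mul_left, tsum_geometric_of_lt_one hρ.le hρ1, mul_assoc,
    mul_inv_cancel₀ (by linarith), mul_one] at this
  linarith

end DyadicRecursion

/-! ### Iterated dyadic differences of the exponential -/

/-- Iterated dyadic differences of `y ↦ exp (-y)`; the `j`-th one vanishes to order `j` at `0`. -/
noncomputable def heatDiff : ℕ → ℝ → ℝ
  | 0, y => Real.exp (-y)
  | j + 1, y => heatDiff j (2 * y) - 2 ^ j * heatDiff j y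

lemma continuous_heatDiff (j : ℕ) : Continuous (heatDiff j) := by
  induction j with
  | zero => simp only [heatDiff]; fun_prop
  | succ j ih => simp only [heatDiff]; fun_prop

lemma exists_abs_heatDiff_le_exp (j : ℕ) :
    ∃ C : ℝ, 0 < C ∧ ∀ y, 0 ≤ y → |heatDiff j y| ≤ C * Real.exp (-y) := by
  induction j with
  | zero => exact ⟨1, one_pos, fun y _ => by simp [heatDiff]⟩
  | succ j ih =>
    obtain ⟨C, hC, h⟩ := ih
    refine ⟨C + 2 ^ j * C, by positivity, fun y hy => ?_⟩
    simp only [heatDiff]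
    have h1 := h (2 * y) (by linarith)
    have h2 := h y hy
    have h3 : Real.exp (-(2 * y)) ≤ Real.exp (-y) := Real.exp_le_exp.2 (by linarith)
    calc _ ≤ |heatDiff j (2 * y)| + |2 ^ j * heatDiff j y| := abs_sub _ _
      _ = |heatDiff j (2 * y)| + 2 ^ j * |heatDiff j y| := by
        rw [abs_mul, abs_of_pos (by positivity : (0 : ℝ) < 2 ^ j)]
      _ ≤ C * Real.exp (-y) + 2 ^ j * (C * Real.exp (-y)) := by
        gcongr
        exact h1.trans (by gcongr)
      _ = _ := by ring

/-- The step f(y) ↦ f(2y) - 2^i f(y) multiplies the coefficient of y^n by 2^n - 2^i, so the steps i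
< j annihilate all powers below y^j. -/
lemma hasSum_heatDiff (j : ℕ) (y : ℝ) :
    HasSum (fun n : ℕ => ((-1) ^ n / (n.factorial : ℝ) *
      ∏ i ∈ Finset.range j, ((2 : ℝ) ^ n - 2 ^ i)) * y ^ n) (heatDiff j y) := by
  induction j generalizing y with
  | zero =>
    simp only [heatDiff, Finset.range_zero, Finset.prod_empty, mul_one]
    have := NormedSpace.expSeries_div_hasSum_exp (𝔸 := ℝ) (-y)
    rw [← Real.exp_eq_exp_ℝ] at this
    refine this.congr_fun fun n => ?_
    rw [neg_pow]; ring
  | succ j ih =>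
    simp only [heatDiff]
    refine ((ih (2 * y)).sub ((ih y).mul_left (2 ^ j))).congr_fun fun n => ?_
    rw [Finset.prod_range_succ, mul_pow]; ring

lemma exists_abs_heatDiff_le_pow (j : ℕ) :
    ∃ C : ℝ, 0 < C ∧ ∀ y, 0 ≤ y → y ≤ 1 → |heatDiff j y| ≤ C * y ^ j := by
  set c : ℕ → ℝ := fun n => (-1) ^ n / (n.factorial : ℝ) *
      ∏ i ∈ Finset.range j, ((2 : ℝ) ^ n - 2 ^ i) with hc
  have hsum : Summable fun n => |c n| := by
    have := (hasSum_heatDiff j 1).summable.abs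
    simpa only [one_pow, mul_one] using this
  refine ⟨(∑' n, |c n|) + 1, by
    have : 0 ≤ ∑' n, |c n| := tsum_nonneg fun _ => abs_nonneg _
    linarith, fun y hy hy1 => ?_⟩
  have hle : ∀ n, ‖c n * y ^ n‖ ≤ |c n| * y ^ j := by
    intro n
    rw [norm_mul, Real.norm_eq_abs, Real.norm_of_nonneg (by positivity)]
    by_cases hn : j ≤ n
    · exact mul_le_mul_of_nonneg_left (pow_le_pow_of_le_one hy hy1 hn) (abs_nonneg _)
    · have : c n = 0 := by
        simp only [hc]
        rw [Finset.prod_eq_zero (Finset.mem_range.2 (not_le.1 hn)) (sub_self _), mul_zero]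
      simp [this]
  rw [← (hasSum_heatDiff j y).tsum_eq, ← Real.norm_eq_abs]
  refine (tsum_of_norm_bounded (hsum.mul_right (y ^ j)).hasSum hle).trans ?_
  rw [tsum_mul_right]
  gcongr
  linarith

/-- Half of the exponential decay is kept, so that a Gaussian can later be split off and still leave
a pure power bound. -/
lemma exists_abs_heatDiff_le_rpow (j : ℕ) (θ : ℝ) (hθ : 0 ≤ θ) (hθj : θ ≤ j) :
    ∃ C : ℝ, 0 < C ∧ ∀ y, 0 ≤ y → |heatDiff j y| ≤ C * y ^ θ * Real.exp (-(y / 2)) := by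
  obtain ⟨C₁, hC₁, h₁⟩ := exists_abs_heatDiff_le_exp j
  obtain ⟨C₂, hC₂, h₂⟩ := exists_abs_heatDiff_le_pow j
  refine ⟨C₁ + C₂ * Real.exp 1, by positivity, fun y hy => ?_⟩
  have e0 := Real.exp_pos (-(y / 2))
  have e1 : 0 ≤ y ^ θ := Real.rpow_nonneg hy _
  rcases le_total y 1 with h | h
  · have a1 : y ^ j ≤ y ^ θ := by
      rw [← Real.rpow_natCast]
      exact Real.rpow_le_rpow_of_exponent_ge' hy h hθ hθj
    have a2 : 1 ≤ Real.exp 1 * Real.exp (-(y / 2)) := by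
      rw [← Real.exp_add]; exact Real.one_le_exp (by linarith)
    calc _ ≤ C₂ * y ^ j := h₂ y hy h
      _ ≤ C₂ * y ^ θ := by gcongr
      _ ≤ C₂ * y ^ θ * (Real.exp 1 * Real.exp (-(y / 2))) :=
        le_mul_of_one_le_right (by positivity) a2
      _ ≤ _ := by
        have : 0 ≤ C₁ * y ^ θ * Real.exp (-(y / 2)) := by positivity
        nlinarith
  · have a1 : 1 ≤ y ^ θ := Real.one_le_rpow h hθ
    have a2 : Real.exp (-y) ≤ Real.exp (-(y / 2)) := Real.exp_le_exp.2 (by linarith)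
    calc _ ≤ C₁ * Real.exp (-y) := h₁ y hy
      _ ≤ C₁ * Real.exp (-(y / 2)) := by gcongr
      _ ≤ C₁ * y ^ θ * Real.exp (-(y / 2)) := by
        gcongr; exact le_mul_of_one_le_right hC₁.le a1
      _ ≤ _ := by
        have : 0 ≤ C₂ * Real.exp 1 * y ^ θ * Real.exp (-(y / 2)) := by positivity
        nlinarith

/-! ### Hausdorff content -/

section Content

variable {d : ℕ}

/-- The Hausdorff content as an outer measure. -/
noncomputable def hausdorffContentOuter {d : ℕ} (t : ℝ) (ht : 0 < t) :
    OuterMeasure (EuclideanSpace ℝ (Fin d)) :=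
  OuterMeasure.ofFunction (fun U => Metric.ediam U ^ t) (by simp [ht])

lemma hausdorffContentOuter_apply {t : ℝ} (ht : 0 < t) (A : Set (EuclideanSpace ℝ (Fin d))) :
    hausdorffContentOuter t ht A = hausdorffContent t A := by
  rw [hausdorffContentOuter, OuterMeasure.ofFunction_apply]; rfl

lemma hausdorffContent_mono {t : ℝ} (ht : 0 < t) {A B : Set (EuclideanSpace ℝ (Fin d))}
    (h : A ⊆ B) : hausdorffContent t A ≤ hausdorffContent t B := by
  simp only [← hausdorffContentOuter_apply ht]; exact measure_mono h

lemma hausdorffContent_iUnion_le {ι : Type*} [Countable ι] {t : ℝ} (ht : 0 < t)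
    (A : ι → Set (EuclideanSpace ℝ (Fin d))) :
    hausdorffContent t (⋃ i, A i) ≤ ∑' i, hausdorffContent t (A i) := by
  simp only [← hausdorffContentOuter_apply ht]; exact measure_iUnion_le _

lemma hausdorffContent_le_ediam {t : ℝ} (ht : 0 < t) (A : Set (EuclideanSpace ℝ (Fin d))) :
    hausdorffContent t A ≤ Metric.ediam A ^ t := by
  rw [← hausdorffContentOuter_apply ht]; exact OuterMeasure.ofFunction_le A

/-- A Vitali family of disjoint r-balls centred in S lies in G, which limits their number by volume,
while the concentric balls of radius 4r, of diameter at most 8r, cover S. -/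
lemma hausdorffContent_mul_volume_ball_le {t r : ℝ} (ht : 0 < t) (hr : 0 < r)
    (S G : Set (EuclideanSpace ℝ (Fin d))) (hSG : ∀ x ∈ S, Metric.closedBall x r ⊆ G) :
    hausdorffContent t S * volume (Metric.closedBall (0 : EuclideanSpace ℝ (Fin d)) r)
      ≤ ENNReal.ofReal (8 * r) ^ t * volume G := by
  obtain ⟨u, huS, hdis, hcov⟩ := Vitali.exists_disjoint_subfamily_covering_enlargement_closedBall
    S (fun x => x) (fun _ => r) r (fun _ _ => le_rfl) 4 (by norm_num)
  have hcount : u.Countable := hdis.countable_of_nonempty_interior fun x _ =>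
    ⟨x, by rw [mem_interior_iff_mem_nhds]; exact Metric.closedBall_mem_nhds x hr⟩
  have : Countable u := hcount.to_subtype
  have hsub : S ⊆ ⋃ x : u, Metric.closedBall (x : EuclideanSpace ℝ (Fin d)) (4 * r) := by
    intro x hx
    obtain ⟨b, hb, hxb⟩ := hcov x hx
    exact Set.mem_iUnion.2 ⟨⟨b, hb⟩, hxb (Metric.mem_closedBall_self hr.le)⟩
  calc _ ≤ (∑' _ : u, ENNReal.ofReal (8 * r) ^ t)
        * volume (Metric.closedBall (0 : EuclideanSpace ℝ (Fin d)) r) := by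
        gcongr
        refine (hausdorffContent_mono ht hsub).trans ((hausdorffContent_iUnion_le ht _).trans ?_)
        refine ENNReal.tsum_le_tsum fun x => (hausdorffContent_le_ediam ht _).trans ?_
        gcongr
        refine Metric.ediam_le fun a ha b hb => ?_
        rw [edist_dist]
        refine ENNReal.ofReal_le_ofReal ?_
        have := dist_triangle_right a b x
        rw [Metric.mem_closedBall] at ha hb
        linarith
    _ = ENNReal.ofReal (8 * r) ^ t * ∑' x : u, volume (Metric.closedBall
          (x : EuclideanSpace ℝ (Fin d)) r) := by
        rw [← ENNReal.tsum_mul_left, ← ENNReal.tsum_mul_right]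
        congr! 2 with x
        rw [Measure.addHaar_closedBall_center volume (x : EuclideanSpace ℝ (Fin d))]
    _ = ENNReal.ofReal (8 * r) ^ t * volume (⋃ x ∈ u, Metric.closedBall x r) := by
        rw [measure_biUnion hcount hdis fun x _ => Metric.isClosed_closedBall.measurableSet]
    _ ≤ _ := by
        gcongr
        exact Set.iUnion₂_subset fun x hx => hSG x (huS hx)

end Content

/-! ### Modulated Gaussians as Schwartz functions -/

section Gaussian

variable {V : Type*} [NormedAddCommGroup V]

/-- By Leibniz and Df = f · L, each derivative of f is controlled by lower ones times derivatives of
L, which grow polynomially; the rapid decay of f therefore passes to all orders. -/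
lemma exists_schwartzMap_eq_of_hasFDerivAt_smul [NormedSpace ℝ V] {f : V → ℂ}
    {L : V → V →L[ℝ] ℂ} (hL : L.HasTemperateGrowth) (hf : ContDiff ℝ ∞ f)
    (hfL : ∀ x, HasFDerivAt f (f x • L x) x)
    (hdec : ∀ k : ℕ, ∃ C : ℝ, ∀ x, (1 + ‖x‖) ^ k * ‖f x‖ ≤ C) :
    ∃ F : 𝓢(V, ℂ), ∀ x, F x = f x := by
  have key : ∀ n k : ℕ, ∃ C : ℝ, ∀ x, (1 + ‖x‖) ^ k * ‖iteratedFDeriv ℝ n f x‖ ≤ C := by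
    intro n
    induction n using Nat.strong_induction_on with
    | _ n ih =>
      intro k
      rcases n with _ | n
      · simpa only [norm_iteratedFDeriv_zero] using hdec k
      · obtain ⟨m, C, hC, hLb⟩ := hL.norm_iteratedFDeriv_le_uniform n
        have hder : fderiv ℝ f = fun x => f x • L x := funext fun x => (hfL x).fderiv
        have ih' : ∀ i : ℕ, ∃ D : ℝ, i < n + 1 → ∀ x,
            (1 + ‖x‖) ^ (k + m) * ‖iteratedFDeriv ℝ i f x‖ ≤ D := by
          intro i
          by_cases hi : i < n + 1
          · obtain ⟨D, hD⟩ := ih i hi (k + m)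
            exact ⟨D, fun _ => hD⟩
          -- Junk value, so that the bounds can be chosen for all i at once.
          · exact ⟨0, fun h => absurd h hi⟩
        choose D hD using ih'
        refine ⟨∑ i ∈ Finset.range (n + 1), (n.choose i : ℝ) * D i * C, fun x => ?_⟩
        rw [← norm_iteratedFDeriv_fderiv, hder]
        calc _ ≤ (1 + ‖x‖) ^ k * ∑ i ∈ Finset.range (n + 1), (n.choose i : ℝ) *
              ‖iteratedFDeriv ℝ i f x‖ * ‖iteratedFDeriv ℝ (n - i) L x‖ := by
              gcongr
              exact norm_iteratedFDeriv_smul_le hf hL.1 x (by exact_mod_cast le_top)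
          _ ≤ _ := by
            rw [Finset.mul_sum]
            refine Finset.sum_le_sum fun i hi => ?_
            have h1 := hD i (Finset.mem_range.1 hi) x
            have h2 := hLb (n - i) (Nat.sub_le _ _) x
            calc _ ≤ (1 + ‖x‖) ^ k * ((n.choose i : ℝ) * ‖iteratedFDeriv ℝ i f x‖ *
                  (C * (1 + ‖x‖) ^ m)) := by gcongr
              _ = (n.choose i : ℝ) * ((1 + ‖x‖) ^ (k + m) * ‖iteratedFDeriv ℝ i f x‖) * C := by
                rw [pow_add]; ring
              _ ≤ _ := by gcongr
  refine ⟨⟨f, hf, fun k n => ?_⟩, fun x => rfl⟩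
  obtain ⟨C, hC⟩ := key n k
  refine ⟨C, fun x => le_trans ?_ (hC x)⟩
  gcongr
  linarith

lemma exists_one_add_pow_mul_exp_le {b : ℝ} (hb : 0 < b) (k : ℕ) :
    ∃ C : ℝ, ∀ r : ℝ, 0 ≤ r → (1 + r) ^ k * Real.exp (-b * r ^ 2) ≤ C := by
  refine ⟨k.factorial * Real.exp (1 + 1 / (4 * b)), fun r hr => ?_⟩
  have h1 := Real.pow_div_factorial_le_exp (1 + r) (by linarith) k
  rw [div_le_iff₀ (by positivity)] at h1
  have h2 : 1 + r + -b * r ^ 2 ≤ 1 + 1 / (4 * b) := by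
    have : 0 ≤ b * (r - 1 / (2 * b)) ^ 2 := by positivity
    have e : b * (r - 1 / (2 * b)) ^ 2 = b * r ^ 2 - r + 1 / (4 * b) := by field_simp; ring
    linarith
  calc _ ≤ (Real.exp (1 + r) * k.factorial) * Real.exp (-b * r ^ 2) := by gcongr
    _ = k.factorial * Real.exp (1 + r + -b * r ^ 2) := by rw [Real.exp_add (1 + r)]; ring
    _ ≤ _ := by gcongr

variable [InnerProductSpace ℝ V]

lemma norm_modulated_gaussian (b : ℝ) (x v : V) :
    ‖Complex.exp (-b * ‖v‖ ^ 2 + 2 * Real.pi * Complex.I * inner ℝ x v)‖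
      = Real.exp (-b * ‖v‖ ^ 2) := by
  rw [Complex.norm_exp]
  congr 1
  have e : ((‖v‖ : ℂ) ^ 2).re = ‖v‖ ^ 2 := by rw [← Complex.ofReal_pow, Complex.ofReal_re]
  simp [Complex.mul_re, e]

lemma exists_schwartzMap_eq_modulated_gaussian {b : ℝ} (hb : 0 < b) (x : V) :
    ∃ F : 𝓢(V, ℂ), ∀ v, F v =
      Complex.exp (-b * ‖v‖ ^ 2 + 2 * Real.pi * Complex.I * inner ℝ x v) := by
  let A : V →L[ℝ] V →L[ℝ] ℂ :=
    (-(2 * b)) • ((ContinuousLinearMap.compL ℝ V ℝ ℂ Complex.ofRealCLM) ∘L (innerSL ℝ))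
  let B : V →L[ℝ] ℂ := (2 * Real.pi * Complex.I) • (Complex.ofRealCLM ∘L (innerSL ℝ x))
  have hsm : ContDiff ℝ ∞ fun v : V => -(b : ℂ) * ‖v‖ ^ 2 +
      2 * Real.pi * Complex.I * (inner ℝ x v : ℝ) := by
    have h1 : ContDiff ℝ ∞ fun v : V => ((‖v‖ ^ 2 : ℝ) : ℂ) :=
      Complex.ofRealCLM.contDiff.comp (contDiff_norm_sq ℝ)
    have h2 : ContDiff ℝ ∞ fun v : V => ((inner ℝ x v : ℝ) : ℂ) :=
      Complex.ofRealCLM.contDiff.comp (contDiff_const.inner ℝ contDiff_id)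
    simp only [Complex.ofReal_pow] at h1
    exact (contDiff_const.mul h1).add (contDiff_const.mul h2)
  refine exists_schwartzMap_eq_of_hasFDerivAt_smul (L := fun v => A v + B) ?_ hsm.cexp ?_ ?_
  · exact A.hasTemperateGrowth.add (Function.HasTemperateGrowth.const B)
  · intro v
    refine HasFDerivAt.cexp ?_
    have h1 : HasFDerivAt (fun v : V => ((‖v‖ ^ 2 : ℝ) : ℂ))
        (Complex.ofRealCLM ∘L (2 • (innerSL ℝ v))) v :=
      Complex.ofRealCLM.hasFDerivAt.comp v (hasStrictFDerivAt_norm_sq v).hasFDerivAt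
    have h2 : HasFDerivAt (fun v : V => ((inner ℝ x v : ℝ) : ℂ))
        (Complex.ofRealCLM ∘L (innerSL ℝ x)) v :=
      Complex.ofRealCLM.hasFDerivAt.comp v (innerSL ℝ x).hasFDerivAt
    simp only [Complex.ofReal_pow] at h1
    refine ((h1.const_mul (-(b : ℂ))).add (h2.const_mul (2 * Real.pi * Complex.I))).congr_fderiv ?_
    ext w
    have e : (innerSL ℝ : V →L[ℝ] V →L[ℝ] ℝ) v w = inner ℝ v w := rfl
    simp [A, B, e]
    ring
  · intro k
    obtain ⟨C, hC⟩ := exists_one_add_pow_mul_exp_le hb k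
    refine ⟨C, fun v => ?_⟩
    rw [norm_modulated_gaussian]
    exact hC _ (norm_nonneg v)

end Gaussian

/-! ### Plancherel for integrable square-integrable functions, and Gaussian smoothing -/

section Plancherel

variable {V : Type*} [NormedAddCommGroup V] [InnerProductSpace ℝ V] [FiniteDimensional ℝ V]
  [MeasurableSpace V] [BorelSpace V]

lemma integral_mul_fourierInv_eq {h G : V → ℂ} (hh : Integrable h) (hG : Integrable G) :
    ∫ y, h y * 𝓕⁻ G y = ∫ ξ, 𝓕⁻ h ξ * G ξ := by
  have h1 := VectorFourier.integral_fourierIntegral_smul_eq_flip (μ := (volume : Measure V))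
    (ν := (volume : Measure V)) (L := -innerₗ V) Real.continuous_fourierChar
    (by simp only [LinearMap.neg_apply, innerₗ_apply_apply]; fun_prop) hh hG
  simp only [smul_eq_mul] at h1
  have h2 : (-innerₗ V).flip = -innerₗ V := by
    ext v w; simp [real_inner_comm]
  rw [h2] at h1
  exact h1.symm

lemma continuous_fourierInv_of_integrable {G : V → ℂ} (hG : Integrable G) :
    Continuous (𝓕⁻ G) :=
  VectorFourier.fourierIntegral_continuous (L := -innerₗ V) Real.continuous_fourierChar
    (by simp only [LinearMap.neg_apply, innerₗ_apply_apply]; fun_prop) hG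

/-- Testing against smooth compactly supported functions identifies the inverse Fourier integral
with the L² transform, which is an isometry. -/
lemma lintegral_enorm_sq_fourierInv {G : V → ℂ} (hG : Integrable G) (hG2 : MemLp G 2) :
    ∫⁻ y, ‖𝓕⁻ G y‖ₑ ^ 2 = ∫⁻ ξ, ‖G ξ‖ₑ ^ 2 := by
  have hcont := continuous_fourierInv_of_integrable hG
  set H : Lp ℂ 2 (volume : Measure V) := 𝓕⁻ (hG2.toLp G) with hH
  have hae : ∀ᵐ y, 𝓕⁻ G y = H y := by
    refine ae_eq_of_integral_contDiff_smul_eq hcont.locallyIntegrable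
      ((Lp.memLp H).locallyIntegrable (by norm_num)) fun φ hφ hsupp => ?_
    have hφ' : ContDiff ℝ ∞ fun y => (φ y : ℂ) := Complex.ofRealCLM.contDiff.comp hφ
    have hsupp' : HasCompactSupport fun y => (φ y : ℂ) :=
      hsupp.comp_left (g := ((↑) : ℝ → ℂ)) Complex.ofReal_zero
    let Φ : 𝓢(V, ℂ) := hsupp'.toSchwartzMap hφ'
    have e1 : ∀ y, Φ y = (φ y : ℂ) := fun y => rfl
    have e2 : ∫ y, Φ y * 𝓕⁻ G y = ∫ ξ, 𝓕⁻ (Φ : V → ℂ) ξ * G ξ :=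
      integral_mul_fourierInv_eq Φ.integrable hG
    have e3 : ∫ y, Φ y * H y = ∫ ξ, 𝓕⁻ (Φ : V → ℂ) ξ * G ξ := by
      have := congrArg (fun T => T Φ) (Lp.fourierInv_toTemperedDistribution_eq (hG2.toLp G))
      simp only [TemperedDistribution.fourierInv_apply, Lp.toTemperedDistribution_apply,
        smul_eq_mul] at this
      rw [← hH] at this
      rw [← this]
      refine integral_congr_ae ?_
      filter_upwards [hG2.coeFn_toLp] with ξ hξ
      rw [hξ, SchwartzMap.fourierInv_coe]
    calc _ = ∫ y, Φ y * 𝓕⁻ G y := by simp [e1]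
      _ = ∫ y, Φ y * H y := by rw [e2, e3]
      _ = _ := by simp [e1]
  have hn : eLpNorm H 2 volume = eLpNorm G 2 volume := by
    have h1 : ‖H‖ = ‖hG2.toLp G‖ := (Lp.fourierTransformₗᵢ V ℂ).symm.norm_map _
    rw [Lp.norm_def, Lp.norm_def, ENNReal.toReal_eq_toReal_iff' (Lp.eLpNorm_ne_top _)
      (Lp.eLpNorm_ne_top _)] at h1
    rw [h1]
    exact eLpNorm_congr_ae hG2.coeFn_toLp
  rw [← eLpNorm_congr_ae hae, eLpNorm_eq_lintegral_rpow_enorm_toReal (by norm_num) (by norm_num),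
    eLpNorm_eq_lintegral_rpow_enorm_toReal (by norm_num) (by norm_num)] at hn
  have := ENNReal.rpow_left_injective (x := 1 / (2 : ℝ≥0∞).toReal) (by norm_num) hn
  simpa using this

/-- Multiplication by a Gaussian on the Fourier side is convolution with a Gaussian. -/
lemma fourierInv_gaussian_mul {b : ℝ} (hb : 0 < b) {G : V → ℂ} (hG : Integrable G) (x : V) :
    𝓕⁻ (fun ξ => (Real.exp (-b * ‖ξ‖ ^ 2) : ℂ) * G ξ) x =
      ∫ y, (((Real.pi / b) ^ (Module.finrank ℝ V / 2 : ℝ) *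
        Real.exp (-(Real.pi ^ 2 / b) * ‖x - y‖ ^ 2) : ℝ) : ℂ) * 𝓕⁻ G y := by
  obtain ⟨F, hF⟩ := exists_schwartzMap_eq_modulated_gaussian hb x
  have hF' : (F : V → ℂ) = fun v => Complex.exp (-(b : ℂ) * ‖v‖ ^ 2 +
      2 * Real.pi * Complex.I * inner ℝ x v) := funext hF
  have hinv : 𝓕⁻ (𝓕 (F : V → ℂ)) = F := by
    rw [← SchwartzMap.fourier_coe, ← SchwartzMap.fourierInv_coe, FourierTransform.fourierInv_fourier_eq]
  have hint : Integrable (𝓕 (F : V → ℂ)) := by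
    rw [← SchwartzMap.fourier_coe]; exact (𝓕 F).integrable
  have h1 := integral_mul_fourierInv_eq hint hG
  rw [hinv] at h1
  have h2 : ∀ y, 𝓕 (F : V → ℂ) y = (((Real.pi / b) ^ (Module.finrank ℝ V / 2 : ℝ) *
        Real.exp (-(Real.pi ^ 2 / b) * ‖x - y‖ ^ 2) : ℝ) : ℂ) := by
    intro y
    rw [hF', fourier_gaussian_innerProductSpace' (by simpa using hb) x y]
    rw [Complex.ofReal_mul, Complex.ofReal_cpow (by positivity)]
    push_cast
    congr 2
    ring
  simp only [h2] at h1
  rw [h1, Real.fourierInv_eq']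
  refine integral_congr_ae (Filter.Eventually.of_forall fun ξ => ?_)
  simp only [hF, smul_eq_mul]
  rw [← mul_assoc, Complex.ofReal_exp, ← Complex.exp_add]
  congr 2
  rw [real_inner_comm]
  push_cast
  ring

end Plancherel

lemma lintegral_mul_sq_le {α : Type*} [MeasurableSpace α] {μ : Measure α} {f h : α → ℝ≥0∞}
    (hf : AEMeasurable f μ) (hh : AEMeasurable h μ) :
    (∫⁻ x, f x * h x ∂μ) ^ 2 ≤ (∫⁻ x, f x ^ 2 ∂μ) * ∫⁻ x, h x ^ 2 ∂μ := by
  have h1 := ENNReal.lintegral_mul_le_Lp_mul_Lq μ Real.HolderConjugate.two_two hf hh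
  have e : ∀ a : ℝ≥0∞, (a ^ (1 / 2 : ℝ)) ^ 2 = a := fun a => by
    rw [← ENNReal.rpow_natCast, ← ENNReal.rpow_mul]; norm_num
  calc _ ≤ _ := pow_le_pow_left' h1 2
    _ = _ := by rw [mul_pow, e, e]; simp only [ENNReal.rpow_ofNat]

/-! ### Heat averages of a measure and their dyadic differences -/

section HeatPairing

variable {d : ℕ}

/-- The inverse Fourier transform of `ξ ↦ heatDiff j (π τ |ξ|²) g(ξ)`. -/
noncomputable def heatPairing {d : ℕ} (g : EuclideanSpace ℝ (Fin d) → ℂ) (j : ℕ) (τ : ℝ) :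
    EuclideanSpace ℝ (Fin d) → ℂ :=
  𝓕⁻ (fun ξ => (heatDiff j (Real.pi * τ * ‖ξ‖ ^ 2) : ℂ) * g ξ)

lemma IsFourierTransformOf.integrable_gaussian_mul {X : Measure (EuclideanSpace ℝ (Fin d))}
    {g : EuclideanSpace ℝ (Fin d) → ℂ} (hg : IsFourierTransformOf X g) {b : ℝ} (hb : 0 < b) :
    Integrable fun ξ => (Real.exp (-b * ‖ξ‖ ^ 2) : ℂ) * g ξ := by
  obtain ⟨F, hF⟩ := exists_schwartzMap_eq_modulated_gaussian hb (0 : EuclideanSpace ℝ (Fin d))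
  refine (hg.integrable_mul F).congr (Filter.Eventually.of_forall fun ξ => ?_)
  simp [hF]

lemma integrable_mul_of_abs_le_gaussian {g : EuclideanSpace ℝ (Fin d) → ℂ}
    (hgm : AEStronglyMeasurable g volume)
    (hg : ∀ b : ℝ, 0 < b → Integrable fun ξ => (Real.exp (-b * ‖ξ‖ ^ 2) : ℂ) * g ξ)
    {m : EuclideanSpace ℝ (Fin d) → ℝ} (hm : Continuous m) {b C : ℝ} (hb : 0 < b)
    (hC : ∀ ξ, |m ξ| ≤ C * Real.exp (-b * ‖ξ‖ ^ 2)) :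
    Integrable fun ξ => (m ξ : ℂ) * g ξ := by
  refine ((hg b hb).norm.const_mul C).mono'
    ((Complex.continuous_ofReal.comp hm).aestronglyMeasurable.mul hgm)
    (Filter.Eventually.of_forall fun ξ => ?_)
  rw [norm_mul, norm_mul, Complex.norm_real, Complex.norm_real, ← mul_assoc, Real.norm_eq_abs,
    Real.norm_of_nonneg (Real.exp_pos _).le]
  gcongr
  exact hC ξ

lemma integrable_heatDiff_mul {g : EuclideanSpace ℝ (Fin d) → ℂ}
    (hgm : AEStronglyMeasurable g volume)
    (hg : ∀ b : ℝ, 0 < b → Integrable fun ξ => (Real.exp (-b * ‖ξ‖ ^ 2) : ℂ) * g ξ)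
    (j : ℕ) {τ : ℝ} (hτ : 0 < τ) :
    Integrable fun ξ => (heatDiff j (Real.pi * τ * ‖ξ‖ ^ 2) : ℂ) * g ξ := by
  obtain ⟨C, -, hC⟩ := exists_abs_heatDiff_le_exp j
  have hc := continuous_heatDiff j
  refine integrable_mul_of_abs_le_gaussian hgm hg (b := Real.pi * τ) (C := C)
    (hc.comp (by fun_prop)) (by positivity) fun ξ => ?_
  rw [neg_mul]
  exact hC _ (by positivity)

lemma heatPairing_succ {g : EuclideanSpace ℝ (Fin d) → ℂ}
    (hgm : AEStronglyMeasurable g volume)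
    (hg : ∀ b : ℝ, 0 < b → Integrable fun ξ => (Real.exp (-b * ‖ξ‖ ^ 2) : ℂ) * g ξ)
    (j : ℕ) {τ : ℝ} (hτ : 0 < τ) (x : EuclideanSpace ℝ (Fin d)) :
    heatPairing g (j + 1) τ x = heatPairing g j (2 * τ) x - (2 ^ j : ℝ) • heatPairing g j τ x := by
  have key : ∀ G : EuclideanSpace ℝ (Fin d) → ℂ, Integrable G →
      Integrable fun ξ => Complex.exp (↑(2 * Real.pi * inner ℝ ξ x) * Complex.I) • G ξ := by
    intro G hG
    have hc : Continuous fun ξ : EuclideanSpace ℝ (Fin d) =>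
        Complex.exp (↑(2 * Real.pi * inner ℝ ξ x) * Complex.I) := by fun_prop
    refine hG.norm.mono' (hc.aestronglyMeasurable.smul hG.1)
      (Filter.Eventually.of_forall fun ξ => ?_)
    rw [norm_smul, Complex.norm_exp_ofReal_mul_I, one_mul]
  have h1 := key _ (integrable_heatDiff_mul hgm hg j hτ)
  have h2 := key _ (integrable_heatDiff_mul hgm hg j (τ := 2 * τ) (by positivity))
  simp only [heatPairing, Real.fourierInv_eq']
  rw [← integral_smul]
  refine Eq.trans ?_ (integral_sub h2 (h1.smul (2 ^ j : ℝ)))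
  refine integral_congr_ae (Filter.Eventually.of_forall fun ξ => ?_)
  have e : Real.pi * (2 * τ) * ‖ξ‖ ^ 2 = 2 * (Real.pi * τ * ‖ξ‖ ^ 2) := by ring
  simp only [heatDiff, e, smul_eq_mul, Complex.real_smul]
  push_cast
  ring

lemma gaussian_integrable_of_temperate {X : Measure (EuclideanSpace ℝ (Fin d))}
    (hX : X.HasTemperateGrowth) {b : ℝ} (hb : 0 < b) (x : EuclideanSpace ℝ (Fin d)) :
    Integrable (fun y => Real.exp (-b * ‖x - y‖ ^ 2)) X := by
  obtain ⟨C, hC⟩ := exists_one_add_pow_mul_exp_le hb X.integrablePower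
  have hmaj := (Measure.integrable_pow_neg_integrablePower X).const_mul
    ((1 + ‖x‖) ^ X.integrablePower * C)
  refine hmaj.mono' (Continuous.aestronglyMeasurable (by fun_prop))
    (Filter.Eventually.of_forall fun y => ?_)
  rw [Real.norm_of_nonneg (Real.exp_pos _).le, Real.rpow_neg (by positivity), Real.rpow_natCast,
    ← div_eq_mul_inv, le_div_iff₀ (by positivity)]
  have h1 : 1 + ‖y‖ ≤ (1 + ‖x‖) * (1 + ‖x - y‖) := by
    have h2 : ‖y‖ ≤ ‖x‖ + ‖x - y‖ := by
      have := norm_sub_le x (x - y)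
      rwa [sub_sub_cancel] at this
    nlinarith [norm_nonneg x, norm_nonneg (x - y)]
  calc _ ≤ Real.exp (-b * ‖x - y‖ ^ 2) * ((1 + ‖x‖) * (1 + ‖x - y‖)) ^ X.integrablePower := by
        gcongr
    _ = (1 + ‖x‖) ^ X.integrablePower *
        ((1 + ‖x - y‖) ^ X.integrablePower * Real.exp (-b * ‖x - y‖ ^ 2)) := by
        rw [mul_pow]; ring
    _ ≤ _ := by
        gcongr
        exact hC _ (norm_nonneg _)

/-- The distributional identity defining g is tested on a Gaussian modulated by x, whose Fourier
transform is the heat kernel centred at x. -/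
lemma heatPairing_zero {X : Measure (EuclideanSpace ℝ (Fin d))}
    {g : EuclideanSpace ℝ (Fin d) → ℂ} (hg : IsFourierTransformOf X g) {τ : ℝ} (hτ : 0 < τ)
    (x : EuclideanSpace ℝ (Fin d)) :
    heatPairing g 0 τ x =
      ((τ ^ (-(d / 2 : ℝ)) * ∫ y, Real.exp (-(Real.pi / τ) * ‖x - y‖ ^ 2) ∂X : ℝ) : ℂ) := by
  have hb : 0 < Real.pi * τ := by positivity
  obtain ⟨F, hF⟩ := exists_schwartzMap_eq_modulated_gaussian hb x
  have hF' : (F : EuclideanSpace ℝ (Fin d) → ℂ) = fun v =>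
      Complex.exp (-((Real.pi * τ : ℝ) : ℂ) * ‖v‖ ^ 2 +
        2 * Real.pi * Complex.I * inner ℝ x v) := funext hF
  have h2 : ∀ y, 𝓕 (F : EuclideanSpace ℝ (Fin d) → ℂ) y = ((τ ^ (-(d / 2 : ℝ)) *
        Real.exp (-(Real.pi / τ) * ‖x - y‖ ^ 2) : ℝ) : ℂ) := by
    intro y
    rw [hF', fourier_gaussian_innerProductSpace' (by simpa using hb) x y]
    have e1 : (Real.pi / (Real.pi * τ : ℝ) : ℂ) = ((τ⁻¹ : ℝ) : ℂ) := by
      push_cast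
      have : (Real.pi : ℂ) ≠ 0 := by exact_mod_cast Real.pi_ne_zero
      have : (τ : ℂ) ≠ 0 := by exact_mod_cast hτ.ne'
      field_simp
    rw [e1, Complex.ofReal_mul (τ ^ (-(d / 2 : ℝ))), Real.rpow_neg hτ.le, ← Real.inv_rpow hτ.le,
      Complex.ofReal_cpow (inv_nonneg.2 hτ.le), finrank_euclideanSpace_fin]
    push_cast
    congr 2
    have : (Real.pi : ℂ) ≠ 0 := by exact_mod_cast Real.pi_ne_zero
    have : (τ : ℂ) ≠ 0 := by exact_mod_cast hτ.ne'
    field_simp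
  have h3 := hg.integral_fourier F
  simp only [h2] at h3
  rw [integral_complex_ofReal, integral_const_mul] at h3
  rw [h3, heatPairing, Real.fourierInv_eq']
  refine integral_congr_ae (Filter.Eventually.of_forall fun ξ => ?_)
  simp only [hF, heatDiff, smul_eq_mul]
  rw [← mul_assoc, Complex.ofReal_exp, ← Complex.exp_add]
  congr 2
  rw [real_inner_comm]
  push_cast
  ring

lemma summable_pow_mul_exp_neg_two_pow {B c : ℝ} (hB : 0 < B) (hc : 0 < c) :
    Summable fun k : ℕ => B ^ k * Real.exp (-(c * 2 ^ k)) := by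
  obtain ⟨n, hn⟩ := pow_unbounded_of_one_lt B (one_lt_two : (1 : ℝ) < 2)
  have hq : B / 2 ^ n < 1 := by rw [div_lt_one (by positivity)]; exact hn
  refine Summable.of_nonneg_of_le (fun k => by positivity) (fun k => ?_)
    ((summable_geometric_of_lt_one (by positivity) hq).mul_left (n.factorial / c ^ n))
  have h1 := Real.pow_div_factorial_le_exp (c * 2 ^ k) (by positivity) n
  rw [Real.exp_neg]
  calc _ ≤ B ^ k * ((c * 2 ^ k) ^ n / n.factorial)⁻¹ := by gcongr
    _ = _ := by
      rw [mul_pow, div_pow, ← pow_mul, ← pow_mul, mul_comm k n]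
      field_simp

/-- A ball of radius ρ about x is X-null. Half of the Gaussian exponent then yields exp(-πρ²/(2τ)),
doubly exponential in k, and the other half keeps the integral over X finite uniformly in τ ≤ 2. -/
lemma summable_heatPairing_of_notMem_support {X : Measure (EuclideanSpace ℝ (Fin d))}
    {g : EuclideanSpace ℝ (Fin d) → ℂ} (hg : IsFourierTransformOf X g) {b : ℝ} (hb : 0 < b)
    {x : EuclideanSpace ℝ (Fin d)} (hx : x ∉ X.support) :
    Summable fun k : ℕ => b ^ k * ‖heatPairing g 0 (2 * (1 / 2) ^ k) x‖ := by
  obtain ⟨U, hU, hXU⟩ := Measure.notMem_support_iff_exists.1 hx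
  obtain ⟨ρ, hρ, hball⟩ := Metric.mem_nhds_iff.1 hU
  have hae : ∀ᵐ y ∂X, ρ ≤ ‖x - y‖ := by
    refine measure_mono_null (fun y hy => hball ?_) hXU
    simp only [Set.mem_compl_iff, Set.mem_ofPred_eq, not_le] at hy
    rwa [Metric.mem_ball, dist_comm, dist_eq_norm]
  set A := ∫ y, Real.exp (-(Real.pi / 4) * ‖x - y‖ ^ 2) ∂X with hA
  have hA0 : 0 ≤ A := integral_nonneg fun y => (Real.exp_pos _).le
  have hmain := (summable_pow_mul_exp_neg_two_pow (B := b * 2 ^ (d / 2 : ℝ))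
    (c := Real.pi * ρ ^ 2 / 4) (by positivity) (by positivity)).mul_left A
  refine Summable.of_nonneg_of_le (fun k => by positivity) (fun k => ?_) hmain
  have hτ : (0 : ℝ) < 2 * (1 / 2) ^ k := by positivity
  set τ : ℝ := 2 * (1 / 2) ^ k with hτdef
  have hτ2 : τ ≤ 2 := by
    have : (1 / 2 : ℝ) ^ k ≤ 1 := pow_le_one₀ (by norm_num) (by norm_num)
    linarith
  have hτi : τ⁻¹ = 2 ^ k / 2 := by rw [hτdef]; field_simp; rw [← mul_pow]; norm_num
  have h1 : ∫ y, Real.exp (-(Real.pi / τ) * ‖x - y‖ ^ 2) ∂X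
      ≤ Real.exp (-(Real.pi * ρ ^ 2 / 4 * 2 ^ k)) * A := by
    rw [hA, ← integral_const_mul]
    refine integral_mono_ae (gaussian_integrable_of_temperate hg.temperate (by positivity) x)
      ((gaussian_integrable_of_temperate hg.temperate (by positivity) x).const_mul _) ?_
    filter_upwards [hae] with y hy
    rw [← Real.exp_add]
    refine Real.exp_le_exp.2 ?_
    have h2 : ρ ^ 2 ≤ ‖x - y‖ ^ 2 := by gcongr
    have h3 : 1 / 2 ≤ τ⁻¹ := by
      rw [one_div]; exact inv_anti₀ hτ hτ2
    rw [div_eq_mul_inv Real.pi τ]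
    have e : (2 : ℝ) ^ k = 2 * τ⁻¹ := by rw [hτi]; ring
    rw [e]
    have a1 : Real.pi / 2 * τ⁻¹ * ρ ^ 2 ≤ Real.pi / 2 * τ⁻¹ * ‖x - y‖ ^ 2 := by gcongr
    have a2 : Real.pi / 2 * (1 / 2) * ‖x - y‖ ^ 2 ≤ Real.pi / 2 * τ⁻¹ * ‖x - y‖ ^ 2 := by gcongr
    linarith
  rw [heatPairing_zero hg hτ, Complex.norm_real, Real.norm_of_nonneg
    (mul_nonneg (by positivity) (integral_nonneg fun y => (Real.exp_pos _).le))]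
  have h4 : τ ^ (-(d / 2 : ℝ)) ≤ (2 ^ (d / 2 : ℝ)) ^ k := by
    rw [Real.rpow_neg hτ.le, ← Real.inv_rpow hτ.le, hτi,
      ← Real.rpow_natCast (2 ^ (d / 2 : ℝ)), ← Real.rpow_mul (by norm_num), mul_comm _ (k : ℝ),
      Real.rpow_mul (by norm_num), Real.rpow_natCast]
    refine Real.rpow_le_rpow (by positivity) ?_ (by positivity)
    have : (0 : ℝ) < 2 ^ k := by positivity
    linarith
  calc _ ≤ b ^ k * ((2 ^ (d / 2 : ℝ)) ^ k * (Real.exp (-(Real.pi * ρ ^ 2 / 4 * 2 ^ k)) * A)) := by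
        gcongr
    _ = _ := by rw [mul_pow]; ring

/-- A bounded compactly supported φ lies below a multiple of a Gaussian, and positivity of X
preserves the comparison. -/
lemma exists_mollify_le_heatPairing {φ : EuclideanSpace ℝ (Fin d) → ℝ} (hφ : Continuous φ)
    (hφs : HasCompactSupport φ) (hφ0 : ∀ x, 0 ≤ φ x) :
    ∃ C : ℝ, 0 < C ∧ ∀ (X : Measure (EuclideanSpace ℝ (Fin d))) (g : EuclideanSpace ℝ (Fin d) → ℂ),
      IsFourierTransformOf X g → ∀ Δ τ : ℝ, 0 < Δ → Δ ^ 2 ≤ τ → τ ≤ 2 * Δ ^ 2 → ∀ x,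
      mollify φ X Δ x ≤ C * ‖heatPairing g 0 τ x‖ := by
  have hc : Continuous fun y => Real.exp (Real.pi * ‖y‖ ^ 2) * φ y := by fun_prop
  obtain ⟨C, hC⟩ := (hφs.mul_left (f := fun y =>
    Real.exp (Real.pi * ‖y‖ ^ 2))).exists_bound_of_continuous hc
  have hC0 : 0 ≤ C := (norm_nonneg _).trans (hC 0)
  have hb : ∀ y, φ y ≤ C * Real.exp (-(Real.pi * ‖y‖ ^ 2)) := by
    intro y
    have : Real.exp (Real.pi * ‖y‖ ^ 2) * φ y ≤ C := (le_abs_self _).trans (hC y)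
    rw [Real.exp_neg, ← div_eq_mul_inv, le_div_iff₀ (Real.exp_pos _)]
    linarith
  refine ⟨2 ^ (d / 2 : ℝ) * (C + 1), by positivity, fun X g hg Δ τ hΔ h1 h2 x => ?_⟩
  have hτ : 0 < τ := lt_of_lt_of_le (by positivity) h1
  rw [heatPairing_zero hg hτ, Complex.norm_real, Real.norm_of_nonneg
    (mul_nonneg (by positivity) (integral_nonneg fun y => (Real.exp_pos _).le)), ← mul_assoc,
    mollify, ← integral_const_mul]
  refine integral_mono_of_nonneg (Filter.Eventually.of_forall fun y => ?_)
    ((gaussian_integrable_of_temperate hg.temperate (by positivity) x).const_mul _)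
    (Filter.Eventually.of_forall fun y => ?_)
  · exact mul_nonneg (by positivity) (hφ0 _)
  · simp only [rescale]
    have k1 : (Δ ^ d)⁻¹ ≤ 2 ^ (d / 2 : ℝ) * τ ^ (-(d / 2 : ℝ)) := by
      have e : Δ ^ d = (Δ ^ 2) ^ (d / 2 : ℝ) := by
        rw [← Real.rpow_natCast, ← Real.rpow_natCast, ← Real.rpow_mul hΔ.le]
        congr 1; push_cast; ring
      rw [e, Real.rpow_neg hτ.le, ← div_eq_mul_inv, ← Real.div_rpow (by norm_num) hτ.le,
        ← Real.inv_rpow (by positivity)]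
      refine Real.rpow_le_rpow (by positivity) ?_ (by positivity)
      rw [inv_eq_one_div, div_le_div_iff₀ (by positivity) hτ]
      linarith
    have k2 : φ (Δ⁻¹ • (x - y)) ≤ (C + 1) * Real.exp (-(Real.pi / τ) * ‖x - y‖ ^ 2) := by
      refine (hb _).trans ?_
      gcongr
      · linarith
      · rw [norm_smul, Real.norm_of_nonneg (by positivity), mul_pow, neg_mul, neg_le_neg_iff,
          div_eq_mul_inv, mul_assoc]
        gcongr
        rw [inv_pow]
        exact inv_anti₀ (by positivity) h1
    calc _ ≤ 2 ^ (d / 2 : ℝ) * τ ^ (-(d / 2 : ℝ)) *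
          ((C + 1) * Real.exp (-(Real.pi / τ) * ‖x - y‖ ^ 2)) := by
          gcongr
          exact hφ0 _
      _ = _ := by ring

end HeatPairing

/-! ### Pointwise and weak-type estimates -/

section Estimates

variable {d : ℕ}

lemma integrable_norm_rpow_mul_exp_neg_mul_sq (hd : 0 < d) {p b : ℝ} (hp : -(d : ℝ) < p)
    (hb : 0 < b) :
    Integrable fun ξ : EuclideanSpace ℝ (Fin d) => ‖ξ‖ ^ p * Real.exp (-b * ‖ξ‖ ^ 2) := by
  have : Nonempty (Fin d) := ⟨⟨0, hd⟩⟩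
  refine (integrable_fun_norm_addHaar volume (f := fun r : ℝ => r ^ p * Real.exp (-b * r ^ 2))).2 ?_
  have h := integrableOn_rpow_mul_exp_neg_mul_sq hb (s := (d - 1 : ℝ) + p) (by linarith)
  refine h.congr_fun (fun r hr => ?_) measurableSet_Ioi
  have hr0 : (0 : ℝ) < r := hr
  simp only [finrank_euclideanSpace_fin, smul_eq_mul]
  rw [Real.rpow_add hr0, ← Real.rpow_natCast r (d - 1), Nat.cast_sub hd, Nat.cast_one, mul_assoc]

/-- Pointwise bound for the pairings which vanish at the origin on the Fourier side. -/
lemma exists_enorm_heatPairing_sq_le (hd : 0 < d) {s : ℝ} (hs : s ≤ d) {j : ℕ} (hj : 1 ≤ j)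
    {τ : ℝ} (hτ : 0 < τ) :
    ∃ K : ℝ≥0∞, K ≠ ⊤ ∧ ∀ g : EuclideanSpace ℝ (Fin d) → ℂ, AEStronglyMeasurable g volume → ∀ x,
      ‖heatPairing g j τ x‖ₑ ^ 2 ≤ K * ∫⁻ ξ, ‖g ξ‖ₑ ^ 2 * ‖ξ‖ₑ ^ s := by
  have : Nonempty (Fin d) := ⟨⟨0, hd⟩⟩
  obtain ⟨C, hC, hCb⟩ := exists_abs_heatDiff_le_rpow j 1 zero_le_one (by exact_mod_cast hj)
  have hcont := continuous_heatDiff j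
  refine ⟨∫⁻ ξ : EuclideanSpace ℝ (Fin d),
    (‖heatDiff j (Real.pi * τ * ‖ξ‖ ^ 2)‖ₑ * ‖ξ‖ₑ ^ (-(s / 2))) ^ 2, ?_, fun g hg x => ?_⟩
  -- One order of vanishing contributes |ξ|⁴ to the squared kernel, so s ≤ d suffices at the origin.
  -- Without it the power would be |ξ|^(-s), not integrable when s = d.
  · have hint := (integrable_norm_rpow_mul_exp_neg_mul_sq hd (p := 4 - s)
      (b := Real.pi * τ) (by linarith) (by positivity)).const_mul ((C * (Real.pi * τ)) ^ 2)
    refine ne_top_of_le_ne_top hint.2.ne ?_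
    refine lintegral_mono_ae ?_
    filter_upwards [compl_mem_ae_iff.2 (measure_singleton (0 : EuclideanSpace ℝ (Fin d)))] with ξ hξ
    have hξ0 : 0 < ‖ξ‖ := norm_pos_iff.2 (by simpa using hξ)
    have e1 : ‖ξ‖ₑ ^ (-(s / 2)) = ENNReal.ofReal (‖ξ‖ ^ (-(s / 2))) := by
      rw [← ofReal_norm, ENNReal.ofReal_rpow_of_pos hξ0]
    rw [e1, ← ofReal_norm (heatDiff j _), ← ENNReal.ofReal_mul (norm_nonneg _),
      ← ENNReal.ofReal_pow (by positivity), ← ofReal_norm]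
    refine ENNReal.ofReal_le_ofReal ?_
    rw [Real.norm_eq_abs (heatDiff j _), Real.norm_of_nonneg (by positivity)]
    have h1 := hCb (Real.pi * τ * ‖ξ‖ ^ 2) (by positivity)
    rw [Real.rpow_one] at h1
    calc _ ≤ (C * (Real.pi * τ * ‖ξ‖ ^ 2) * Real.exp (-(Real.pi * τ * ‖ξ‖ ^ 2 / 2)) *
          ‖ξ‖ ^ (-(s / 2))) ^ 2 := by gcongr
      _ = (C * (Real.pi * τ)) ^ 2 * ((‖ξ‖ ^ (4 : ℕ) * (‖ξ‖ ^ (-(s / 2))) ^ 2) *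
          (Real.exp (-(Real.pi * τ * ‖ξ‖ ^ 2 / 2))) ^ 2) := by ring
      _ = _ := by
        rw [← Real.exp_nat_mul, ← Real.rpow_natCast (‖ξ‖ ^ (-(s / 2))), ← Real.rpow_mul hξ0.le,
          ← Real.rpow_natCast ‖ξ‖ 4, ← Real.rpow_add hξ0]
        congr 3
        · push_cast; ring
        · push_cast; ring
  · have h1 : ‖heatPairing g j τ x‖ₑ ≤ ∫⁻ ξ,
        (‖heatDiff j (Real.pi * τ * ‖ξ‖ ^ 2)‖ₑ * ‖ξ‖ₑ ^ (-(s / 2))) *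
          (‖g ξ‖ₑ * ‖ξ‖ₑ ^ (s / 2)) := by
      rw [heatPairing, Real.fourierInv_eq']
      refine (enorm_integral_le_lintegral_enorm _).trans (lintegral_mono_ae ?_)
      filter_upwards [compl_mem_ae_iff.2 (measure_singleton (0 : EuclideanSpace ℝ (Fin d)))] with ξ hξ
      have hξ0 : ‖ξ‖ₑ ≠ 0 := enorm_ne_zero.2 (by simpa using hξ)
      have e : ‖ξ‖ₑ ^ (-(s / 2)) * ‖ξ‖ₑ ^ (s / 2) = 1 := by
        rw [← ENNReal.rpow_add _ _ hξ0 enorm_ne_top]; simp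
      have e2 : ‖Complex.exp (↑(2 * Real.pi * inner ℝ ξ x) * Complex.I)‖ₑ = 1 := by
        rw [← ofReal_norm, Complex.norm_exp_ofReal_mul_I, ENNReal.ofReal_one]
      have e3 : ‖(heatDiff j (Real.pi * τ * ‖ξ‖ ^ 2) : ℂ)‖ₑ
          = ‖heatDiff j (Real.pi * τ * ‖ξ‖ ^ 2)‖ₑ := by
        rw [← ofReal_norm, ← ofReal_norm, Complex.norm_real]
      rw [enorm_smul, enorm_mul, e2, e3, one_mul]
      calc _ = ‖heatDiff j (Real.pi * τ * ‖ξ‖ ^ 2)‖ₑ * ‖g ξ‖ₑ * 1 := (mul_one _).symm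
        _ = ‖heatDiff j (Real.pi * τ * ‖ξ‖ ^ 2)‖ₑ * ‖g ξ‖ₑ *
          (‖ξ‖ₑ ^ (-(s / 2)) * ‖ξ‖ₑ ^ (s / 2)) := by rw [e]
        _ ≤ _ := le_of_eq (by ring)
    have hm1 : AEMeasurable (fun ξ : EuclideanSpace ℝ (Fin d) =>
        ‖heatDiff j (Real.pi * τ * ‖ξ‖ ^ 2)‖ₑ * ‖ξ‖ₑ ^ (-(s / 2))) volume := by
      have : Measurable fun ξ : EuclideanSpace ℝ (Fin d) =>
        heatDiff j (Real.pi * τ * ‖ξ‖ ^ 2) := (hcont.comp (by fun_prop)).measurable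
      exact (this.enorm.mul (measurable_enorm.pow_const _)).aemeasurable
    have hm2 : AEMeasurable (fun ξ : EuclideanSpace ℝ (Fin d) =>
        ‖g ξ‖ₑ * ‖ξ‖ₑ ^ (s / 2)) volume :=
      hg.enorm.mul (measurable_enorm.pow_const _).aemeasurable
    refine (pow_le_pow_left' h1 2).trans ((lintegral_mul_sq_le hm1 hm2).trans (le_of_eq ?_))
    congr 1
    refine lintegral_congr fun ξ => ?_
    rw [mul_pow, ← ENNReal.rpow_natCast (‖ξ‖ₑ ^ (s / 2)), ← ENNReal.rpow_mul]
    congr 2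
    push_cast; ring

lemma lintegral_gaussian {b : ℝ} (hb : 0 < b) :
    ∫⁻ y : EuclideanSpace ℝ (Fin d), ENNReal.ofReal (Real.exp (-b * ‖y‖ ^ 2)) =
      ENNReal.ofReal ((Real.pi / b) ^ (d / 2 : ℝ)) := by
  have h := GaussianFourier.integral_rexp_neg_mul_sq_norm (V := EuclideanSpace ℝ (Fin d)) hb
  rw [finrank_euclideanSpace_fin] at h
  rw [← h, ofReal_integral_eq_lintegral_ofReal _ (Filter.Eventually.of_forall fun y =>
    (Real.exp_pos _).le)]
  by_contra hni
  rw [integral_undef hni] at h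
  have : 0 < (Real.pi / b) ^ (d / 2 : ℝ) := by positivity
  linarith

/-- A Gaussian average of `V` is locally controlled by the mean square of `V`. -/
lemma enorm_gaussian_average_sq_le {V : EuclideanSpace ℝ (Fin d) → ℂ} (hV : Continuous V)
    {τ : ℝ} (hτ : 0 < τ) {x z : EuclideanSpace ℝ (Fin d)} (hz : ‖z - x‖ ^ 2 ≤ τ) :
    ‖∫ y, (((2 / τ) ^ (d / 2 : ℝ) * Real.exp (-(2 * Real.pi / τ) * ‖x - y‖ ^ 2) : ℝ) : ℂ) * V y‖ₑ ^ 2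
      ≤ ∫⁻ y, ENNReal.ofReal (Real.exp (2 * Real.pi) * (2 / τ) ^ (d / 2 : ℝ) *
        Real.exp (-(Real.pi / τ) * ‖z - y‖ ^ 2)) * ‖V y‖ₑ ^ 2 := by
  set p : EuclideanSpace ℝ (Fin d) → ℝ := fun y =>
    (2 / τ) ^ (d / 2 : ℝ) * Real.exp (-(2 * Real.pi / τ) * ‖x - y‖ ^ 2) with hp
  have hp0 : ∀ y, 0 ≤ p y := fun y => by positivity
  have hpc : Continuous p := by fun_prop
  have hsq : ∀ y, ENNReal.ofReal (√(p y)) ^ 2 = ENNReal.ofReal (p y) := fun y => by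
    rw [← ENNReal.ofReal_pow (Real.sqrt_nonneg _), Real.sq_sqrt (hp0 y)]
  have h1 : ‖∫ y, (p y : ℂ) * V y‖ₑ ≤
      ∫⁻ y, ENNReal.ofReal (√(p y)) * (ENNReal.ofReal (√(p y)) * ‖V y‖ₑ) := by
    refine (enorm_integral_le_lintegral_enorm _).trans (le_of_eq (lintegral_congr fun y => ?_))
    rw [enorm_mul, ← mul_assoc, ← sq, hsq, ← ofReal_norm, Complex.norm_real,
      Real.norm_of_nonneg (hp0 y)]
  have hm : AEMeasurable (fun y => ENNReal.ofReal (√(p y))) volume :=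
    (ENNReal.measurable_ofReal.comp (hpc.sqrt).measurable).aemeasurable
  have hone : ∫⁻ y, ENNReal.ofReal (p y) = 1 := by
    have e : ∀ y, ENNReal.ofReal (p y) = ENNReal.ofReal ((2 / τ) ^ (d / 2 : ℝ)) *
        ENNReal.ofReal (Real.exp (-(2 * Real.pi / τ) * ‖x - y‖ ^ 2)) := fun y =>
      ENNReal.ofReal_mul (by positivity)
    simp only [e]
    rw [lintegral_const_mul' _ _ ENNReal.ofReal_ne_top,
      lintegral_sub_left_eq_self (fun w : EuclideanSpace ℝ (Fin d) =>
        ENNReal.ofReal (Real.exp (-(2 * Real.pi / τ) * ‖w‖ ^ 2))) x,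
      lintegral_gaussian (by positivity), ← ENNReal.ofReal_mul (by positivity),
      ← Real.mul_rpow (by positivity) (by positivity)]
    have : 2 / τ * (Real.pi / (2 * Real.pi / τ)) = 1 := by field_simp
    rw [this, Real.one_rpow, ENNReal.ofReal_one]
  refine (pow_le_pow_left' h1 2).trans ((lintegral_mul_sq_le hm
    (hm.mul hV.measurable.enorm.aemeasurable)).trans ?_)
  simp only [hsq, Pi.mul_apply, mul_pow]
  rw [hone, one_mul]
  refine lintegral_mono fun y => ?_
  refine mul_le_mul_left (ENNReal.ofReal_le_ofReal ?_) _
  rw [mul_comm (Real.exp (2 * Real.pi)), mul_assoc, ← Real.exp_add]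
  refine mul_le_mul_of_nonneg_left (Real.exp_le_exp.2 ?_) (by positivity)
  -- Halving the Gaussian exponent, from 2π/τ to π/τ, absorbs the shift from x to z at the cost of
  -- the factor exp(2π).
  have h2 : ‖z - y‖ ^ 2 ≤ 2 * ‖x - y‖ ^ 2 + 2 * τ := by
    have h3 : ‖z - y‖ ≤ ‖z - x‖ + ‖x - y‖ := norm_sub_le_norm_sub_add_norm_sub z x y
    nlinarith [norm_nonneg (z - y), norm_nonneg (z - x), norm_nonneg (x - y),
      sq_nonneg (‖z - x‖ - ‖x - y‖)]
  have h4 : Real.pi / τ * ‖z - y‖ ^ 2 ≤ Real.pi / τ * (2 * ‖x - y‖ ^ 2 + 2 * τ) := by gcongr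
  have h5 : Real.pi / τ * (2 * ‖x - y‖ ^ 2 + 2 * τ) =
      2 * Real.pi / τ * ‖x - y‖ ^ 2 + 2 * Real.pi := by field_simp
  linarith

/-- Weak-type estimate in Hausdorff content for Gaussian averages. -/
lemma hausdorffContent_gaussian_average_le {t : ℝ} (ht : 0 < t)
    {V : EuclideanSpace ℝ (Fin d) → ℂ} (hV : Continuous V) {τ lam : ℝ} (hτ : 0 < τ) :
    hausdorffContent t {x | lam ≤ ‖∫ y, (((2 / τ) ^ (d / 2 : ℝ) *
        Real.exp (-(2 * Real.pi / τ) * ‖x - y‖ ^ 2) : ℝ) : ℂ) * V y‖} *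
      volume (Metric.closedBall (0 : EuclideanSpace ℝ (Fin d)) √τ) * ENNReal.ofReal (lam) ^ 2 ≤
    ENNReal.ofReal (8 * √τ) ^ t *
      (ENNReal.ofReal (Real.exp (2 * Real.pi) * 2 ^ (d / 2 : ℝ)) * ∫⁻ y, ‖V y‖ₑ ^ 2) := by
  set k : EuclideanSpace ℝ (Fin d) → ℝ≥0∞ := fun w =>
    ENNReal.ofReal (Real.exp (2 * Real.pi) * (2 / τ) ^ (d / 2 : ℝ) *
        Real.exp (-(Real.pi / τ) * ‖w‖ ^ 2)) with hk
  have hkm : Measurable k := by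
    refine ENNReal.measurable_ofReal.comp (Continuous.measurable ?_)
    fun_prop
  set N : EuclideanSpace ℝ (Fin d) → ℝ≥0∞ := fun z => ∫⁻ y, k (z - y) * ‖V y‖ₑ ^ 2 with hN
  have hjm : Measurable fun q : EuclideanSpace ℝ (Fin d) × EuclideanSpace ℝ (Fin d) =>
      k (q.1 - q.2) * ‖V q.2‖ₑ ^ 2 :=
    (hkm.comp (measurable_fst.sub measurable_snd)).mul
      ((hV.measurable.comp measurable_snd).enorm.pow_const 2)
  have hNm : Measurable N := hjm.lintegral_prod_right'
  have hkint : ∫⁻ w, k w = ENNReal.ofReal (Real.exp (2 * Real.pi) * 2 ^ (d / 2 : ℝ)) := by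
    have e : ∀ w, k w = ENNReal.ofReal (Real.exp (2 * Real.pi) * (2 / τ) ^ (d / 2 : ℝ)) *
        ENNReal.ofReal (Real.exp (-(Real.pi / τ) * ‖w‖ ^ 2)) := fun w =>
      ENNReal.ofReal_mul (by positivity)
    simp only [e]
    rw [lintegral_const_mul' _ _ ENNReal.ofReal_ne_top, lintegral_gaussian (by positivity),
      ← ENNReal.ofReal_mul (by positivity), mul_assoc,
      ← Real.mul_rpow (by positivity) (by positivity)]
    congr 3
    field_simp
  have hNint : ∫⁻ z, N z = (∫⁻ w, k w) * ∫⁻ y, ‖V y‖ₑ ^ 2 := by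
    simp only [hN]
    rw [lintegral_lintegral_swap hjm.aemeasurable, ← lintegral_const_mul _
      (hV.measurable.enorm.pow_const 2)]
    refine lintegral_congr fun y => ?_
    have hky : Measurable fun z => k (z - y) := hkm.comp (measurable_id.sub_const y)
    rw [lintegral_mul_const _ hky,
      lintegral_sub_right_eq_self k y]
  have hmarkov := mul_meas_ge_le_lintegral hNm (ENNReal.ofReal lam ^ 2) (μ := volume)
  rw [hNint, hkint] at hmarkov
  -- A large average at x makes N large on the whole √τ-ball about x, so Markov's volume bound
  -- becomes a content bound.
  have hcontent := hausdorffContent_mul_volume_ball_le ht (Real.sqrt_pos.2 hτ)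
    {x | lam ≤ ‖∫ y, (((2 / τ) ^ (d / 2 : ℝ) *
        Real.exp (-(2 * Real.pi / τ) * ‖x - y‖ ^ 2) : ℝ) : ℂ) * V y‖}
    {z | ENNReal.ofReal lam ^ 2 ≤ N z} (fun x hx z hz => by
      rw [Metric.mem_closedBall, dist_eq_norm] at hz
      have hz2 : ‖z - x‖ ^ 2 ≤ τ := by
        calc _ ≤ √τ ^ 2 := by gcongr
          _ = τ := Real.sq_sqrt hτ.le
      refine le_trans ?_ (enorm_gaussian_average_sq_le hV hτ hz2)
      refine pow_le_pow_left' ?_ 2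
      rw [← ofReal_norm]
      exact ENNReal.ofReal_le_ofReal hx)
  calc _ ≤ _ := mul_le_mul_left hcontent _
    _ = ENNReal.ofReal (8 * √τ) ^ t * (ENNReal.ofReal lam ^ 2 *
        volume {z | ENNReal.ofReal lam ^ 2 ≤ N z}) := by ring
    _ ≤ _ := by gcongr

end Estimates

/-! ### Content of the superlevel sets of the differences -/

section HeatPairingContent

variable {d : ℕ}

lemma lintegral_enorm_mul_sq_le {g : EuclideanSpace ℝ (Fin d) → ℂ} {s C τ : ℝ} (hs : 0 ≤ s)
    (hτ : 0 < τ) {m : EuclideanSpace ℝ (Fin d) → ℝ}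
    (hm : ∀ ξ, |m ξ| ≤ C * (Real.pi * τ * ‖ξ‖ ^ 2) ^ (s / 4)) :
    ∫⁻ ξ, ‖(m ξ : ℂ) * g ξ‖ₑ ^ 2 ≤ ENNReal.ofReal (C ^ 2 * (Real.pi * τ) ^ (s / 2)) *
      ∫⁻ ξ, ‖g ξ‖ₑ ^ 2 * ‖ξ‖ₑ ^ s := by
  rw [← lintegral_const_mul' _ _ ENNReal.ofReal_ne_top]
  refine lintegral_mono fun ξ => ?_
  have e1 : ‖ξ‖ₑ ^ s = ENNReal.ofReal (‖ξ‖ ^ s) := by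
    rw [← ofReal_norm, ENNReal.ofReal_rpow_of_nonneg (norm_nonneg _) hs]
  have e2 : ‖(m ξ : ℂ)‖ₑ ^ 2 ≤ ENNReal.ofReal (C ^ 2 * (Real.pi * τ) ^ (s / 2)) * ‖ξ‖ₑ ^ s := by
    rw [e1, ← ENNReal.ofReal_mul (by positivity), ← ofReal_norm, ← ENNReal.ofReal_pow
      (norm_nonneg _), Complex.norm_real, Real.norm_eq_abs]
    refine ENNReal.ofReal_le_ofReal ?_
    calc _ ≤ (C * (Real.pi * τ * ‖ξ‖ ^ 2) ^ (s / 4)) ^ 2 := by gcongr; exact hm ξ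
      _ = C ^ 2 * (Real.pi * τ) ^ (s / 2) * ‖ξ‖ ^ s := by
        rw [mul_pow, ← Real.rpow_natCast ((Real.pi * τ * ‖ξ‖ ^ 2) ^ (s / 4)),
          ← Real.rpow_mul (by positivity), Real.mul_rpow (by positivity) (by positivity),
          ← Real.rpow_natCast ‖ξ‖, ← Real.rpow_mul (norm_nonneg _), mul_assoc]
        congr 3
        · push_cast; ring
        · push_cast; ring
  rw [enorm_mul, mul_pow]
  calc _ ≤ (ENNReal.ofReal (C ^ 2 * (Real.pi * τ) ^ (s / 2)) * ‖ξ‖ₑ ^ s) * ‖g ξ‖ₑ ^ 2 := by gcongr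
    _ = _ := by ring

/-- Splitting off half of the Gaussian makes the pairing a Gaussian average at scale √τ of an L²
function. Plancherel supplies τ^(s/2), the covering balls τ^(t/2), and their volume τ^(-d/2). -/
lemma exists_hausdorffContent_heatPairing_le {s t : ℝ} (hs : 0 ≤ s) (ht : 0 < t) {J : ℕ}
    (hJ : s / 4 ≤ J) :
    ∃ K : ℝ, 0 < K ∧ ∀ g : EuclideanSpace ℝ (Fin d) → ℂ, AEStronglyMeasurable g volume →
      (∀ b : ℝ, 0 < b → Integrable fun ξ => (Real.exp (-b * ‖ξ‖ ^ 2) : ℂ) * g ξ) →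
      (∫⁻ ξ, ‖g ξ‖ₑ ^ 2 * ‖ξ‖ₑ ^ s ≠ ⊤) → ∀ τ lam : ℝ, 0 < τ → 0 < lam →
      hausdorffContent t {x | lam ≤ ‖heatPairing g J τ x‖} ≤
        ENNReal.ofReal (K * τ ^ ((s + t - d) / 2) / lam ^ 2) * ∫⁻ ξ, ‖g ξ‖ₑ ^ 2 * ‖ξ‖ₑ ^ s := by
  obtain ⟨C, hC, hCb⟩ := exists_abs_heatDiff_le_rpow J (s / 4) (by positivity) hJ
  obtain ⟨D, hD, hDb⟩ := exists_abs_heatDiff_le_exp J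
  set v := (volume (Metric.ball (0 : EuclideanSpace ℝ (Fin d)) 1)).toReal with hv
  have hvfin : volume (Metric.ball (0 : EuclideanSpace ℝ (Fin d)) 1) ≠ ⊤ := measure_ball_lt_top.ne
  have hv0 : 0 < v := ENNReal.toReal_pos (Metric.measure_ball_pos volume _ one_pos).ne' hvfin
  refine ⟨8 ^ t * (Real.exp (2 * Real.pi) * 2 ^ (d / 2 : ℝ)) * (C ^ 2 * Real.pi ^ (s / 2)) / v,
    by positivity, fun g hgm hg hI τ lam hτ hlam => ?_⟩
  set I := ∫⁻ ξ, ‖g ξ‖ₑ ^ 2 * ‖ξ‖ₑ ^ s with hIdef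
  have hcont := continuous_heatDiff J
  set m : EuclideanSpace ℝ (Fin d) → ℝ := fun ξ =>
    Real.exp (Real.pi * τ * ‖ξ‖ ^ 2 / 2) * heatDiff J (Real.pi * τ * ‖ξ‖ ^ 2) with hm
  have hmc : Continuous m := by
    have : Continuous fun ξ : EuclideanSpace ℝ (Fin d) => heatDiff J (Real.pi * τ * ‖ξ‖ ^ 2) :=
      hcont.comp (by fun_prop)
    fun_prop
  have habs : ∀ ξ, |m ξ| = Real.exp (Real.pi * τ * ‖ξ‖ ^ 2 / 2) *
      |heatDiff J (Real.pi * τ * ‖ξ‖ ^ 2)| := fun ξ => by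
    rw [hm, abs_mul, abs_of_pos (Real.exp_pos _)]
  have hm1 : ∀ ξ, |m ξ| ≤ C * (Real.pi * τ * ‖ξ‖ ^ 2) ^ (s / 4) := fun ξ => by
    rw [habs]
    calc _ ≤ Real.exp (Real.pi * τ * ‖ξ‖ ^ 2 / 2) * (C * (Real.pi * τ * ‖ξ‖ ^ 2) ^ (s / 4) *
          Real.exp (-(Real.pi * τ * ‖ξ‖ ^ 2 / 2))) := by
          gcongr; exact hCb _ (by positivity)
      _ = C * (Real.pi * τ * ‖ξ‖ ^ 2) ^ (s / 4) * (Real.exp (Real.pi * τ * ‖ξ‖ ^ 2 / 2) *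
          Real.exp (-(Real.pi * τ * ‖ξ‖ ^ 2 / 2))) := by ring
      _ = _ := by rw [← Real.exp_add, add_neg_cancel, Real.exp_zero, mul_one]
  have hm2 : ∀ ξ, |m ξ| ≤ D * Real.exp (-(Real.pi * τ / 2) * ‖ξ‖ ^ 2) := fun ξ => by
    rw [habs]
    calc _ ≤ Real.exp (Real.pi * τ * ‖ξ‖ ^ 2 / 2) * (D * Real.exp (-(Real.pi * τ * ‖ξ‖ ^ 2))) := by
          gcongr; exact hDb _ (by positivity)
      _ = D * (Real.exp (Real.pi * τ * ‖ξ‖ ^ 2 / 2) * Real.exp (-(Real.pi * τ * ‖ξ‖ ^ 2))) := by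
          ring
      _ = _ := by rw [← Real.exp_add]; congr 2; ring
  set G : EuclideanSpace ℝ (Fin d) → ℂ := fun ξ => (m ξ : ℂ) * g ξ with hG
  have hGint : Integrable G := integrable_mul_of_abs_le_gaussian hgm hg hmc (by positivity) hm2
  have hGle : ∫⁻ ξ, ‖G ξ‖ₑ ^ 2 ≤ ENNReal.ofReal (C ^ 2 * (Real.pi * τ) ^ (s / 2)) * I :=
    lintegral_enorm_mul_sq_le hs hτ hm1
  have hG2 : MemLp G 2 := by
    refine ⟨hGint.1, ?_⟩
    rw [eLpNorm_lt_top_iff_lintegral_rpow_enorm_lt_top (by norm_num) (by norm_num)]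
    simp only [ENNReal.toReal_ofNat, ENNReal.rpow_ofNat]
    exact lt_of_le_of_lt hGle (ENNReal.mul_lt_top ENNReal.ofReal_lt_top hI.lt_top)
  have hrep : ∀ x, heatPairing g J τ x = ∫ y, (((2 / τ) ^ (d / 2 : ℝ) *
      Real.exp (-(2 * Real.pi / τ) * ‖x - y‖ ^ 2) : ℝ) : ℂ) * 𝓕⁻ G y := by
    intro x
    have h1 := fourierInv_gaussian_mul (b := Real.pi * τ / 2) (by positivity) hGint x
    have e1 : Real.pi / (Real.pi * τ / 2) = 2 / τ := by field_simp
    have e2 : Real.pi ^ 2 / (Real.pi * τ / 2) = 2 * Real.pi / τ := by field_simp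
    rw [finrank_euclideanSpace_fin, e1, e2] at h1
    rw [← h1, heatPairing]
    refine congrArg (fun F : EuclideanSpace ℝ (Fin d) → ℂ => 𝓕⁻ F x) (funext fun ξ => ?_)
    simp only [hG, hm]
    rw [← mul_assoc, ← Complex.ofReal_mul, ← mul_assoc, ← Real.exp_add]
    congr 2
    have : -(Real.pi * τ / 2) * ‖ξ‖ ^ 2 + Real.pi * τ * ‖ξ‖ ^ 2 / 2 = 0 := by ring
    rw [this, Real.exp_zero, one_mul]
  have hmain := hausdorffContent_gaussian_average_le ht
    (continuous_fourierInv_of_integrable hGint) (lam := lam) hτ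
  simp only [← hrep] at hmain
  rw [lintegral_enorm_sq_fourierInv hGint hG2, Measure.addHaar_closedBall _ _ (Real.sqrt_nonneg _),
    finrank_euclideanSpace_fin] at hmain
  have hvE : volume (Metric.ball (0 : EuclideanSpace ℝ (Fin d)) 1) = ENNReal.ofReal v :=
    (ENNReal.ofReal_toReal hvfin).symm
  rw [hvE, ENNReal.ofReal_rpow_of_nonneg (by positivity) ht.le, ← ENNReal.ofReal_pow hlam.le,
    ← ENNReal.ofReal_mul (by positivity), mul_assoc, ← ENNReal.ofReal_mul (by positivity)] at hmain
  have hQ : 0 < √τ ^ d * v * lam ^ 2 := by positivity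
  have h3 : hausdorffContent t {x | lam ≤ ‖heatPairing g J τ x‖} *
      ENNReal.ofReal (√τ ^ d * v * lam ^ 2) ≤
      ENNReal.ofReal ((8 * √τ) ^ t * (Real.exp (2 * Real.pi) * 2 ^ (d / 2 : ℝ)) *
        (C ^ 2 * (Real.pi * τ) ^ (s / 2))) * I := by
    calc _ ≤ _ := hmain
      _ ≤ ENNReal.ofReal ((8 * √τ) ^ t) * (ENNReal.ofReal (Real.exp (2 * Real.pi) *
          2 ^ (d / 2 : ℝ)) * (ENNReal.ofReal (C ^ 2 * (Real.pi * τ) ^ (s / 2)) * I)) := by gcongr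
      _ = _ := by
        rw [ENNReal.ofReal_mul (p := (8 * √τ) ^ t * (Real.exp (2 * Real.pi) * 2 ^ (d / 2 : ℝ)))
          (by positivity), ENNReal.ofReal_mul (p := (8 * √τ) ^ t) (by positivity)]
        ring
  have hQ0 : ENNReal.ofReal (√τ ^ d * v * lam ^ 2) ≠ 0 := (ENNReal.ofReal_pos.2 hQ).ne'
  rw [← ENNReal.le_div_iff_mul_le (Or.inl hQ0) (Or.inl ENNReal.ofReal_ne_top)] at h3
  refine h3.trans (le_of_eq ?_)
  rw [ENNReal.mul_div_right_comm, ← ENNReal.ofReal_div_of_pos hQ]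
  congr 2
  have hsq : √τ = τ ^ (1 / 2 : ℝ) := Real.sqrt_eq_rpow τ
  rw [Real.mul_rpow (by norm_num) (Real.sqrt_nonneg _), Real.mul_rpow (by positivity) hτ.le, hsq,
    ← Real.rpow_natCast (τ ^ (1 / 2 : ℝ)) d, ← Real.rpow_mul hτ.le, ← Real.rpow_mul hτ.le]
  have ed : 1 / 2 * (d : ℝ) = d / 2 := by ring
  have et : 1 / 2 * t = t / 2 := by ring
  rw [ed, et]
  have e : τ ^ ((s + t - d) / 2) * τ ^ (d / 2 : ℝ) = τ ^ (t / 2) * τ ^ (s / 2) := by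
    rw [← Real.rpow_add hτ, ← Real.rpow_add hτ]; congr 1; ring
  rw [div_eq_div_iff (by positivity) (by positivity)]
  have hvv : v * v⁻¹ = 1 := mul_inv_cancel₀ hv0.ne'
  linear_combination (-(8 ^ t * Real.exp (2 * Real.pi) * 2 ^ (d / 2 : ℝ) * C ^ 2 *
    Real.pi ^ (s / 2) * lam ^ 2 : ℝ)) * (e + τ ^ ((s + t - d) / 2) * τ ^ (d / 2 : ℝ) * hvv)

end HeatPairingContent

/-! ### From a large mollification to a large difference, and the theorem -/

section Main

variable {d : ℕ}

/-- The norm is an infimum, so the slack R² < 4R² is what produces an actual g. -/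
lemma exists_isFourierTransformOf_of_homSobolevNorm_le {X : Measure (EuclideanSpace ℝ (Fin d))}
    {s R : ℝ} (hR : 0 < R) (h : homSobolevNorm (s / 2) X ≤ ENNReal.ofReal R) :
    ∃ g, IsFourierTransformOf X g ∧
      ∫⁻ ξ, ‖g ξ‖ₑ ^ 2 * ‖ξ‖ₑ ^ s ≤ ENNReal.ofReal (4 * R ^ 2) := by
  have h1 := ENNReal.rpow_le_rpow h (z := 2) (by norm_num)
  rw [homSobolevNorm, ← ENNReal.rpow_mul, ENNReal.ofReal_rpow_of_pos hR] at h1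
  norm_num at h1
  have h2 := h1.trans_lt ((ENNReal.ofReal_lt_ofReal_iff (q := 4 * R ^ 2) (by positivity)).2 (by
    nlinarith [sq_pos_of_pos hR]))
  obtain ⟨g, hg⟩ := iInf_lt_iff.1 h2
  obtain ⟨hgX, hlt⟩ := iInf_lt_iff.1 hg
  refine ⟨g, hgX, le_trans (le_of_eq (lintegral_congr fun ξ => ?_)) hlt.le⟩
  congr 2
  ring

lemma exists_pos_forall_mul_rpow_le (C : ℝ) {η c : ℝ} (hη : 0 < η) (hc : 0 < c) :
    ∃ Δ₀ : ℝ, 0 < Δ₀ ∧ ∀ Δ, 0 < Δ → Δ ≤ Δ₀ → C * Δ ^ η ≤ c := by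
  have h : Filter.Tendsto (fun Δ : ℝ => C * Δ ^ η) (nhdsWithin 0 (Set.Ioi 0)) (nhds 0) := by
    have : Filter.Tendsto (fun Δ : ℝ => C * Δ ^ η) (nhds 0) (nhds (C * 0 ^ η)) :=
      ((Real.continuousAt_rpow_const 0 η (Or.inr hη.le)).tendsto).const_mul C
    rw [Real.zero_rpow hη.ne', mul_zero] at this
    exact this.mono_left nhdsWithin_le_nhds
  obtain ⟨u, hu, hsub⟩ := mem_nhdsGT_iff_exists_Ioc_subset.1 (h.eventually (gt_mem_nhds hc))
  exact ⟨u, hu, fun Δ h0 h1 => le_of_lt (hsub ⟨h0, h1⟩)⟩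

/-- If `x` is off the support of `X`, a lower bound for the mollification of `X` at `x` forces one
of the dyadic differences of the heat averages of `X` at `x` to be large. -/
lemma exists_heatPairing_ge {s a : ℝ} (hd : 0 < d) (hs : s ≤ d) (ha : 0 < a) (hirr : Irrational a)
    (J : ℕ) {φ : EuclideanSpace ℝ (Fin d) → ℝ} (hφ : Continuous φ) (hφs : HasCompactSupport φ)
    (hφ0 : ∀ x, 0 ≤ φ x) {ρ : ℝ} (hρ : 0 < ρ) (hρ1 : ρ < 1) :
    ∃ c C : ℝ, 0 < c ∧ 0 < C ∧ ∀ (X : Measure (EuclideanSpace ℝ (Fin d)))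
      (g : EuclideanSpace ℝ (Fin d) → ℂ), IsFourierTransformOf X g → ∀ R, 0 ≤ R →
      ∫⁻ ξ, ‖g ξ‖ₑ ^ 2 * ‖ξ‖ₑ ^ s ≤ ENNReal.ofReal (R ^ 2) → ∀ Δ, 0 < Δ → Δ ≤ 1 → ∀ x ∉ X.support,
      ∃ k : ℕ, (c * Δ ^ (-(2 * a)) * mollify φ X Δ x - C * R) * (1 - ρ) * ρ ^ k ≤
        ((2 : ℝ) ^ a) ^ k * ‖heatPairing g (J + 1) (2 * (1 / 2) ^ k) x‖ := by
  have hb1 : (1 : ℝ) < 2 ^ a := Real.one_lt_rpow (by norm_num) ha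
  have hbne : ∀ j : ℕ, (2 : ℝ) ^ a ≠ 2 ^ j := fun j h => by
    rw [← Real.rpow_natCast] at h
    exact hirr.ne_nat j ((Real.rpow_right_inj (by norm_num) (by norm_num)).1 h)
  obtain ⟨A, hA, hAb⟩ := exists_weighted_sum_le (F := ℂ) (2 ^ a) hb1 hbne J
  obtain ⟨B, hB, hBb⟩ := exists_mollify_le_heatPairing hφ hφs hφ0
  have hK : ∀ j : ℕ, ∃ K : ℝ, 0 ≤ K ∧ ∀ g : EuclideanSpace ℝ (Fin d) → ℂ,
      AEStronglyMeasurable g volume → ∀ R, 0 ≤ R →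
      ∫⁻ ξ, ‖g ξ‖ₑ ^ 2 * ‖ξ‖ₑ ^ s ≤ ENNReal.ofReal (R ^ 2) → ∀ x,
      ‖heatPairing g (j + 1) 2 x‖ ≤ K * R := by
    intro j
    obtain ⟨K, hKtop, hKb⟩ := exists_enorm_heatPairing_sq_le hd hs (Nat.le_add_left 1 j) two_pos
    refine ⟨√K.toReal, Real.sqrt_nonneg _, fun g hg R hR hI x => ?_⟩
    have h1 := (hKb g hg x).trans (mul_le_mul_right hI K)
    rw [← ENNReal.ofReal_toReal hKtop, ← ENNReal.ofReal_mul ENNReal.toReal_nonneg, ← ofReal_norm,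
      ← ENNReal.ofReal_pow (norm_nonneg _), ENNReal.ofReal_le_ofReal_iff
        (mul_nonneg ENNReal.toReal_nonneg (sq_nonneg R))] at h1
    refine (sq_le_sq₀ (norm_nonneg _) (mul_nonneg (Real.sqrt_nonneg _) hR)).1 ?_
    rwa [mul_pow, Real.sq_sqrt ENNReal.toReal_nonneg]
  choose K hK0 hKb using hK
  refine ⟨(A * B)⁻¹, (∑ j ∈ Finset.range J, K j) + 1, by positivity, by
    have := Finset.sum_nonneg fun j (_ : j ∈ Finset.range J) => hK0 j
    linarith, fun X g hg R hR hI Δ hΔ hΔ1 x hx => ?_⟩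
  have hgm := hg.locallyIntegrable.aestronglyMeasurable
  have hgi := fun b (hb : (0 : ℝ) < b) => hg.integrable_gaussian_mul hb
  set w : ℕ → ℕ → ℂ := fun j k => heatPairing g j (2 * (1 / 2) ^ k) x with hw
  have hrec : ∀ j k, w (j + 1) (k + 1) = w j k - (2 ^ j : ℝ) • w j (k + 1) := by
    intro j k
    simp only [hw]
    rw [heatPairing_succ hgm hgi j (by positivity)]
    congr 2
    rw [pow_succ]; ring
  have hsum : Summable fun k => ((2 : ℝ) ^ a) ^ k * ‖w 0 k‖ :=
    summable_heatPairing_of_notMem_support hg (by positivity) hx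
  obtain ⟨hsumJ, hle⟩ := hAb w hrec hsum
  refine exists_term_ge_of_le_weighted_sum hρ hρ1 hsumJ ?_
  have hlow : Δ ^ (-(2 * a)) * mollify φ X Δ x ≤ B * ∑' k, ((2 : ℝ) ^ a) ^ k * ‖w 0 k‖ := by
    have hΔ2 : Δ ^ 2 ≤ 1 := pow_le_one₀ hΔ.le hΔ1
    -- Since τ_k = 2 · 2^(-k), the scale 2^(-n) in [Δ², 2Δ²] has index n + 1.
    obtain ⟨n, hn1, hn2⟩ := exists_nat_pow_near_of_lt_one (x := Δ ^ 2) (y := (1 / 2 : ℝ))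
      (by positivity) hΔ2 (by norm_num) (by norm_num)
    have hτ : 2 * (1 / 2 : ℝ) ^ (n + 1) = (1 / 2) ^ n := by rw [pow_succ]; ring
    have hm := hBb X g hg Δ (2 * (1 / 2) ^ (n + 1)) hΔ (by rw [hτ]; exact hn2) (by linarith) x
    have hpow : Δ ^ (-(2 * a)) ≤ ((2 : ℝ) ^ a) ^ (n + 1) := by
      have e1 : ((2 : ℝ) ^ a) ^ (n + 1) = ((1 / 2 : ℝ) ^ (n + 1)) ^ (-a) := by
        rw [← Real.rpow_natCast, ← Real.rpow_mul (by norm_num), ← Real.rpow_natCast (1 / 2),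
          ← Real.rpow_mul (by norm_num), one_div, Real.inv_rpow (by norm_num),
          ← Real.rpow_neg (by norm_num)]
        congr 1; ring
      have e2 : Δ ^ (-(2 * a)) = (Δ ^ 2) ^ (-a) := by
        rw [← Real.rpow_natCast, ← Real.rpow_mul hΔ.le]
        congr 1; push_cast; ring
      rw [e1, e2]
      exact Real.rpow_le_rpow_of_nonpos (by positivity) hn1.le (by linarith)
    have hterm := hsum.le_tsum (n + 1) fun k _ => by positivity
    calc _ ≤ Δ ^ (-(2 * a)) * (B * ‖w 0 (n + 1)‖) := by gcongr
      _ ≤ ((2 : ℝ) ^ a) ^ (n + 1) * (B * ‖w 0 (n + 1)‖) := by gcongr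
      _ = B * (((2 : ℝ) ^ a) ^ (n + 1) * ‖w 0 (n + 1)‖) := by ring
      _ ≤ _ := by gcongr
  have hbd : ∑ j ∈ Finset.range J, ‖w (j + 1) 0‖ ≤ ((∑ j ∈ Finset.range J, K j) + 1) * R := by
    calc _ ≤ ∑ j ∈ Finset.range J, K j * R := by
          refine Finset.sum_le_sum fun j _ => ?_
          simp only [hw, pow_zero, mul_one]
          exact hKb j g hgm R hR hI x
      _ = (∑ j ∈ Finset.range J, K j) * R := by rw [Finset.sum_mul]
      _ ≤ _ := by gcongr; linarith
  have h3 : Δ ^ (-(2 * a)) * mollify φ X Δ x ≤ A * B *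
      ((∑' k, ((2 : ℝ) ^ a) ^ k * ‖w (J + 1) k‖) + ∑ j ∈ Finset.range J, ‖w (j + 1) 0‖) := by
    calc _ ≤ _ := hlow
      _ ≤ B * _ := mul_le_mul_of_nonneg_left hle hB.le
      _ = _ := by ring
  rw [mul_assoc, sub_le_iff_le_add, inv_mul_le_iff₀ (by positivity)]
  refine h3.trans ?_
  gcongr

end Main

theorem proposition4p9 (d : ℕ) (ε₁ ε₂ ε₃ : ℝ) (hε₁ : 0 < ε₁) (hε₂ : 0 < ε₂) (hε₃ : 0 < ε₃)
    (s t : ℝ) (hs : 0 < s) (hsd : s ≤ d) (ht : 0 < t) (htd : t ≤ d)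
    (hst : d + 2 * (ε₁ + ε₂ + ε₃) < s + t)
    (φ : EuclideanSpace ℝ (Fin d) → ℝ) (hφ_smooth : ContDiff ℝ ∞ φ)
    (hφ_supp : HasCompactSupport φ) (hφ_nonneg : ∀ x, 0 ≤ φ x) (hφ_int : ∫ x, φ x = 1) :
    ∃ Δ₀ : ℝ, 0 < Δ₀ ∧ ∀ Δ : ℝ, 0 < Δ → Δ ≤ Δ₀ →
      ∀ X : Measure (EuclideanSpace ℝ (Fin d)), IsLocallyFiniteMeasure X →
        homSobolevNorm (s / 2) X ≤ ENNReal.ofReal (Δ ^ (-ε₃)) →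
        hausdorffContent t (richSet φ X Δ ε₁ \ X.support) ≤ ENNReal.ofReal (Δ ^ ε₂) := by
  have hd : 0 < d := by
    have : (0 : ℝ) < d := hs.trans_le hsd
    exact_mod_cast this
  -- The upper bound makes the sum over scales converge; the lower bound makes the final power of Δ
  -- beat Δ^ε₂.
  obtain ⟨a, hirr, ha1, ha2⟩ := exists_irrational_btwn
    (show (ε₁ + ε₂ + ε₃) / 2 < (s + t - d) / 4 by linarith)
  have ha : 0 < a := by linarith
  obtain ⟨J, hJ⟩ := exists_nat_ge (s / 4)
  set κ := (s + t - d) / 2 with hκ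
  set b : ℝ := 2 ^ a with hb
  have hb0 : 0 < b := by positivity
  -- Ratio of the content bounds at consecutive scales before the pigeonhole loss ρ^(-2). Taking ρ²
  -- midway between q and 1 keeps θ = q/ρ² below 1.
  set q : ℝ := b ^ 2 * (1 / 2 : ℝ) ^ κ with hq
  have hq0 : 0 < q := by positivity
  have hq1 : q < 1 := by
    have : q = 2 ^ (2 * a - κ) := by
      rw [hq, hb, ← Real.rpow_natCast, ← Real.rpow_mul (by norm_num), one_div,
        Real.inv_rpow (by norm_num), ← Real.rpow_neg (by norm_num), ← Real.rpow_add (by norm_num)]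
      congr 1; push_cast; ring
    rw [this]
    exact Real.rpow_lt_one_of_one_lt_of_neg (by norm_num) (by linarith)
  set ρ := √((1 + q) / 2) with hρ
  have hρsq : ρ ^ 2 = (1 + q) / 2 := Real.sq_sqrt (by linarith)
  have hρ0 : 0 < ρ := Real.sqrt_pos.2 (by linarith)
  have hρ1 : ρ < 1 := by nlinarith
  obtain ⟨c, C, hc, hC, hmain⟩ := exists_heatPairing_ge hd hsd ha hirr J hφ_smooth.continuous
    hφ_supp hφ_nonneg hρ0 hρ1
  obtain ⟨K, hK, hcont⟩ := exists_hausdorffContent_heatPairing_le (d := d) hs.le ht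
    (J := J + 1) (hJ.trans (by push_cast; linarith))
  set θ := q / ρ ^ 2 with hθ
  have hθ0 : 0 < θ := by positivity
  have hθ1 : θ < 1 := by rw [hθ, div_lt_one (by positivity), hρsq]; linarith
  set D := K * 2 ^ κ / (c / 2 * (1 - ρ)) ^ 2 * (1 - θ)⁻¹ * 4 with hD
  -- Δ₁ lets half of the main term absorb the low-frequency error; Δ₂ below absorbs the constant D
  -- into the spare power of Δ.
  obtain ⟨Δ₁, hΔ₁, h1⟩ := exists_pos_forall_mul_rpow_le (C * 2) (η := 2 * a - ε₁ - ε₃)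
    (c := c / 2) (by linarith) (by positivity)
  obtain ⟨Δ₂, hΔ₂, h2⟩ := exists_pos_forall_mul_rpow_le D (η := 4 * a - 2 * ε₁ - 2 * ε₃ - ε₂)
    (c := 1) (by linarith) one_pos
  refine ⟨min 1 (min Δ₁ Δ₂), by positivity, fun Δ hΔ hle X _ hX => ?_⟩
  have hle1 : Δ ≤ 1 := hle.trans (min_le_left _ _)
  have k1 := h1 Δ hΔ (hle.trans ((min_le_right _ _).trans (min_le_left _ _)))
  have k2 := h2 Δ hΔ (hle.trans ((min_le_right _ _).trans (min_le_right _ _)))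
  obtain ⟨g, hg, hI⟩ := exists_isFourierTransformOf_of_homSobolevNorm_le (by positivity) hX
  have hgm := hg.locallyIntegrable.aestronglyMeasurable
  have hgi := fun b (hb : (0 : ℝ) < b) => hg.integrable_gaussian_mul hb
  -- The share of scale k in the pigeonhole, divided by its weight b^k.
  set lam : ℕ → ℝ := fun k => c / 2 * (1 - ρ) * Δ ^ (ε₁ - 2 * a) * (ρ / b) ^ k with hlam
  have h1ρ : 0 < 1 - ρ := by linarith
  have hlam0 : ∀ k, 0 < lam k := fun k => by positivity
  have hsub : richSet φ X Δ ε₁ \ X.support ⊆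
      ⋃ k : ℕ, {x | lam k ≤ ‖heatPairing g (J + 1) (2 * (1 / 2) ^ k) x‖} := by
    intro x hx
    obtain ⟨k, hk⟩ := hmain X g hg (2 * Δ ^ (-ε₃)) (by positivity)
      (hI.trans (le_of_eq (by rw [mul_pow]; norm_num))) Δ hΔ hle1 x hx.2
    refine Set.mem_iUnion.2 ⟨k, ?_⟩
    have e1 : c / 2 * Δ ^ (ε₁ - 2 * a) ≤ c * Δ ^ (-(2 * a)) * mollify φ X Δ x -
        C * (2 * Δ ^ (-ε₃)) := by
      have f1 : c * Δ ^ (ε₁ - 2 * a) ≤ c * Δ ^ (-(2 * a)) * mollify φ X Δ x := by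
        have : Δ ^ (ε₁ - 2 * a) = Δ ^ (-(2 * a)) * Δ ^ ε₁ := by
          rw [← Real.rpow_add hΔ]; congr 1; ring
        rw [this, mul_assoc]
        have := hx.1.2
        gcongr
      have f2 : C * (2 * Δ ^ (-ε₃)) ≤ c / 2 * Δ ^ (ε₁ - 2 * a) := by
        have : Δ ^ (-ε₃) = Δ ^ (2 * a - ε₁ - ε₃) * Δ ^ (ε₁ - 2 * a) := by
          rw [← Real.rpow_add hΔ]; congr 1; ring
        rw [this]
        calc _ = C * 2 * Δ ^ (2 * a - ε₁ - ε₃) * Δ ^ (ε₁ - 2 * a) := by ring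
          _ ≤ _ := by gcongr
      linarith
    have e2 : c / 2 * Δ ^ (ε₁ - 2 * a) * (1 - ρ) * ρ ^ k ≤
        b ^ k * ‖heatPairing g (J + 1) (2 * (1 / 2) ^ k) x‖ := by
      refine le_trans ?_ hk
      gcongr
    change lam k ≤ _
    have e3 : lam k = (c / 2 * Δ ^ (ε₁ - 2 * a) * (1 - ρ) * ρ ^ k) / b ^ k := by
      simp only [hlam]; rw [div_pow]; ring
    rw [e3, div_le_iff₀ (by positivity)]
    linarith
  have hterm : ∀ k : ℕ, K * (2 * (1 / 2 : ℝ) ^ k) ^ κ / lam k ^ 2 =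
      K * 2 ^ κ / (c / 2 * (1 - ρ)) ^ 2 * Δ ^ (4 * a - 2 * ε₁) * θ ^ k := by
    intro k
    have f1 : (2 * (1 / 2 : ℝ) ^ k) ^ κ = 2 ^ κ * ((1 / 2 : ℝ) ^ κ) ^ k := by
      rw [Real.mul_rpow (by norm_num) (by positivity), ← Real.rpow_natCast,
        ← Real.rpow_natCast, ← Real.rpow_mul (by norm_num), ← Real.rpow_mul (by norm_num),
        mul_comm κ]
    have f2 : Δ ^ (4 * a - 2 * ε₁) = ((Δ ^ (ε₁ - 2 * a)) ^ 2)⁻¹ := by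
      rw [← Real.rpow_natCast, ← Real.rpow_mul hΔ.le, ← Real.rpow_neg hΔ.le]
      congr 1; push_cast; ring
    have f3 : θ ^ k = (b ^ k) ^ 2 * ((1 / 2 : ℝ) ^ κ) ^ k / (ρ ^ k) ^ 2 := by
      rw [hθ, hq, div_pow, mul_pow, ← pow_mul, ← pow_mul, ← pow_mul, ← pow_mul, mul_comm 2 k]
    have hΔp : 0 < Δ ^ (ε₁ - 2 * a) := by positivity
    rw [f1, f2, f3]
    simp only [hlam]
    rw [div_pow]
    field_simp
  calc hausdorffContent t (richSet φ X Δ ε₁ \ X.support)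
      ≤ ∑' k : ℕ, hausdorffContent t
          {x | lam k ≤ ‖heatPairing g (J + 1) (2 * (1 / 2) ^ k) x‖} :=
        (hausdorffContent_mono ht hsub).trans (hausdorffContent_iUnion_le ht _)
    _ ≤ ∑' k : ℕ, ENNReal.ofReal (K * 2 ^ κ / (c / 2 * (1 - ρ)) ^ 2 * Δ ^ (4 * a - 2 * ε₁) * θ ^ k)
          * ENNReal.ofReal (4 * (Δ ^ (-ε₃)) ^ 2) := by
        refine ENNReal.tsum_le_tsum fun k => ?_
        refine (hcont g hgm hgi (ne_top_of_le_ne_top ENNReal.ofReal_ne_top hI) _ (lam k)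
          (by positivity) (hlam0 k)).trans ?_
        rw [← hterm]
        gcongr
    _ = ENNReal.ofReal (K * 2 ^ κ / (c / 2 * (1 - ρ)) ^ 2 * Δ ^ (4 * a - 2 * ε₁) * (1 - θ)⁻¹)
          * ENNReal.ofReal (4 * (Δ ^ (-ε₃)) ^ 2) := by
        rw [ENNReal.tsum_mul_right, ← ENNReal.ofReal_tsum_of_nonneg (fun k => by positivity)
          ((summable_geometric_of_lt_one hθ0.le hθ1).mul_left _), tsum_mul_left,
          tsum_geometric_of_lt_one hθ0.le hθ1]
    _ = ENNReal.ofReal (D * Δ ^ (4 * a - 2 * ε₁ - 2 * ε₃ - ε₂) * Δ ^ ε₂) := by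
        have h1θ : 0 < 1 - θ := by linarith
        rw [← ENNReal.ofReal_mul (by positivity)]
        congr 1
        have f1 : (Δ ^ (-ε₃)) ^ 2 = Δ ^ (-(2 * ε₃)) := by
          rw [← Real.rpow_natCast, ← Real.rpow_mul hΔ.le]; congr 1; push_cast; ring
        have f2 : Δ ^ (4 * a - 2 * ε₁ - 2 * ε₃ - ε₂) * Δ ^ ε₂ =
            Δ ^ (4 * a - 2 * ε₁) * Δ ^ (-(2 * ε₃)) := by
          rw [← Real.rpow_add hΔ, ← Real.rpow_add hΔ]; congr 1; ring
        rw [mul_assoc D, f1, f2, hD]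
        ring
    _ ≤ ENNReal.ofReal (Δ ^ ε₂) := by
        refine ENNReal.ofReal_le_ofReal ?_
        calc _ ≤ 1 * Δ ^ ε₂ := by gcongr
          _ = _ := one_mul _
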